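/- A super-ring is a $\mathbb{Z}/2$-graded ring $A=A_0\oplus A_1$ with unity that is super-commutative: elements of $A_0$ commute with all homogeneous elements, and $s^2=0$ for every $s\in A_1$. Super-ideals are homogeneous ideals; $A$ is Noetherian if its super-ideals satisfy the ascending chain condition; a super-ideal $\mathfrak p$ is prime if $A/\mathfrak p$ is an integral domain, and then $A_{\mathfrak p}=(A_0\setminus\mathfrak p_0)^{-1}A$, where $\mathfrak p_0=\mathfrak p\cap A_0$. The Krull super-dimension of $A$ is $\mathrm{Ksdim}(A)=r\mid s$, where $r=\mathrm{Ksdim}_0(A)$ is the Krull dimension of $A_0$ and $s=\mathrm{Ksdim}_1(A)$ is the largest length of a system of odd parameters, that is, of a sequence $y_1,\dots,y_s\in A_1$ such that $$\mathrm{Kdim}\bigl(A_0/\mathrm{Ann}_{A_0}(y_1\cdots y_s)\bigr)=\mathrm{Kdim}(A_0).$$ For the zero ring, $\mathrm{Ksdim}(0)=-\infty\mid 0$ by convention. Super-dimension vectors are ordered lexicographically: $a\mid b<c\mid d$ if $a<c$, or $a=c$ and $b<d$; the supremum of the empty set is the least vector $-\infty\mid 0$. **Theorem.** Let $A$ be a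 Noetherian super-ring with $\mathrm{Ksdim}_0(A)<\infty$. Let $I$ be a super-ideal of $A$ and let $\widehat A=\varprojlim_n A/I^n$ be its $I$-adic completion (a super-ring with the grading induced from $A$). Then $$\mathrm{Ksdim}(\widehat A)=\sup_{\mathfrak p\supseteq I}\mathrm{Ksdim}(A_{\mathfrak p}),$$ where $\mathfrak p$ runs over the prime super-ideals of $A$ that contain $I$, and the supremum is taken in the lexicographic order. -/

import Mathlib

/-- A super-commutative super-ring: a ring `A` (with unity) with a `ZMod 2`-grading
`A = 𝒜 0 ⊕ 𝒜 1`, in which even elements commute with all homogeneous elements and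
odd elements have square zero. -/
class SuperRing {A : Type*} [Ring A] (𝒜 : ZMod 2 → AddSubgroup A) extends GradedRing 𝒜 where
  even_comm : ∀ r ∈ 𝒜 0, ∀ i : ZMod 2, ∀ s ∈ 𝒜 i, r * s = s * r
  odd_sq : ∀ s ∈ 𝒜 1, s * s = 0

namespace SuperRing

/-- A `ZMod 2`-indexed family of additive subgroups, closed under multiplication, with
`B = ℬ 0 + ℬ 1` and `ℬ 0 ∩ ℬ 1 = 0`, is a grading. -/
noncomputable abbrev gradedRingOfSum {B : Type*} [Ring B] (ℬ : ZMod 2 → AddSubgroup B)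
    (hm : SetLike.GradedMonoid ℬ)
    (hsum : ∀ x : B, ∃ a ∈ ℬ 0, ∃ b ∈ ℬ 1, a + b = x)
    (hdisj : ∀ x : B, x ∈ ℬ 0 → x ∈ ℬ 1 → x = 0) : GradedRing ℬ :=
  have key : DirectSum.IsInternal ℬ := by
    have hcoe : ∀ x : DirectSum (ZMod 2) (fun i => ℬ i),
        DirectSum.coeAddMonoidHom ℬ x = (x 0 : B) + (x 1 : B) := by
      intro x
      induction x using DirectSum.induction_on with
      | zero => simp
      | of i x =>
        rw [DirectSum.coeAddMonoidHom_of]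
        fin_cases i
        · have h : (DirectSum.of (fun i => ℬ i) (0 : ZMod 2) x) 1 = 0 :=
            DirectSum.of_eq_of_ne _ _ _ (by decide)
          exact (by
            rw [h, DirectSum.of_eq_same]; simp :
            (x : B) = ((DirectSum.of (fun i => ℬ i) (0 : ZMod 2) x) 0 : B)
              + ((DirectSum.of (fun i => ℬ i) (0 : ZMod 2) x) 1 : B))
        · have h : (DirectSum.of (fun i => ℬ i) (1 : ZMod 2) x) 0 = 0 :=
            DirectSum.of_eq_of_ne _ _ _ (by decide)
          exact (by
            rw [h, DirectSum.of_eq_same]; simp :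
            (x : B) = ((DirectSum.of (fun i => ℬ i) (1 : ZMod 2) x) 0 : B)
              + ((DirectSum.of (fun i => ℬ i) (1 : ZMod 2) x) 1 : B))
      | add x y hx hy =>
        rw [map_add, hx, hy]
        simp only [DirectSum.add_apply, AddSubgroup.coe_add]
        abel
    refine ⟨?_, ?_⟩
    · rw [injective_iff_map_eq_zero]
      intro x hx
      rw [hcoe] at hx
      have h1 : ((x 0 : ℬ 0) : B) = -((x 1 : ℬ 1) : B) := eq_neg_of_add_eq_zero_left hx
      have h0 : ((x 0 : ℬ 0) : B) = 0 :=
        hdisj _ (x 0).2 (by rw [h1]; exact neg_mem (x 1).2)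
      have h1' : ((x 1 : ℬ 1) : B) = 0 := by simpa [h0] using hx
      refine DFinsupp.ext fun i => ?_
      fin_cases i
      · exact Subtype.ext h0
      · exact Subtype.ext h1'
    · intro x
      obtain ⟨a, ha, b, hb, rfl⟩ := hsum x
      refine ⟨DirectSum.of (fun i => ℬ i) 0 ⟨a, ha⟩ + DirectSum.of (fun i => ℬ i) 1 ⟨b, hb⟩, ?_⟩
      rw [map_add, DirectSum.coeAddMonoidHom_of, DirectSum.coeAddMonoidHom_of]
  { hm, key.chooseDecomposition with }

variable {A : Type*} [Ring A] (𝒜 : ZMod 2 → AddSubgroup A) [SuperRing 𝒜]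

theorem proj_add_proj (x : A) : GradedRing.proj 𝒜 0 x + GradedRing.proj 𝒜 1 x = x := by
  induction x using DirectSum.Decomposition.inductionOn 𝒜 with
  | zero => simp
  | @homogeneous i m =>
    rw [GradedRing.proj_apply, GradedRing.proj_apply]
    have hi : i = 0 ∨ i = 1 := (by decide : ∀ k : ZMod 2, k = 0 ∨ k = 1) i
    rcases hi with rfl | rfl
    · rw [DirectSum.decompose_of_mem_same 𝒜 m.2,
        DirectSum.decompose_of_mem_ne 𝒜 m.2 (by decide), add_zero]
    · rw [DirectSum.decompose_of_mem_same 𝒜 m.2,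
        DirectSum.decompose_of_mem_ne 𝒜 m.2 (by decide), zero_add]
  | add m m' h h' =>
    rw [map_add, map_add, add_add_add_comm, h, h']

theorem exists_add (x : A) : ∃ a ∈ 𝒜 0, ∃ b ∈ 𝒜 1, a + b = x := by
  refine ⟨GradedRing.proj 𝒜 0 x, SetLike.coe_mem _, GradedRing.proj 𝒜 1 x, SetLike.coe_mem _,
    proj_add_proj 𝒜 x⟩

theorem eq_zero_of_mem_mem {x : A} (h0 : x ∈ 𝒜 0) (h1 : x ∈ 𝒜 1) : x = 0 := by
  have a := DirectSum.decompose_of_mem_same 𝒜 h0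
  rw [DirectSum.decompose_of_mem_ne 𝒜 h1 (by decide)] at a
  exact a.symm

theorem even_comm' {r : A} (hr : r ∈ 𝒜 0) (x : A) : r * x = x * r := by
  obtain ⟨a, ha, b, hb, rfl⟩ := exists_add 𝒜 x
  rw [mul_add, add_mul, even_comm r hr 0 a ha, even_comm r hr 1 b hb]

theorem odd_anticomm {s t : A} (hs : s ∈ 𝒜 1) (ht : t ∈ 𝒜 1) : s * t = -(t * s) := by
  have h := odd_sq (𝒜 := 𝒜) _ (add_mem hs ht)
  rw [add_mul, mul_add, mul_add, odd_sq (𝒜 := 𝒜) s hs, odd_sq (𝒜 := 𝒜) t ht] at h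
  rw [zero_add, add_zero] at h
  exact eq_neg_of_add_eq_zero_left h

/-- The even part `A₀` of a super-ring, as a subring of `A`. -/
def evenPart : Subring A where
  carrier := 𝒜 0
  mul_mem' {a b} ha hb := by
    have h := SetLike.mul_mem_graded (A := 𝒜) ha hb
    rwa [add_zero] at h
  one_mem' := SetLike.one_mem_graded 𝒜
  add_mem' := add_mem
  zero_mem' := zero_mem _
  neg_mem' := neg_mem

instance : CommRing (evenPart 𝒜) :=
  { (inferInstance : Ring (evenPart 𝒜)) with
    mul_comm := fun a b => Subtype.ext (even_comm' 𝒜 a.2 b) }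

instance : Algebra (evenPart 𝒜) A where
  algebraMap := (evenPart 𝒜).subtype
  commutes' r x := even_comm' 𝒜 r.2 x
  smul_def' _ _ := rfl

/-! ### Super-ideals -/

/-- Every (left) super-ideal, i.e. homogeneous left ideal, is two-sided. -/
instance isTwoSided (I : HomogeneousIdeal 𝒜) : I.toIdeal.IsTwoSided where
  mul_mem_of_left {a} b ha := by
    have h0 : GradedRing.proj 𝒜 0 a ∈ I.toIdeal := I.isHomogeneous 0 ha
    have h1 : GradedRing.proj 𝒜 1 a ∈ I.toIdeal := I.isHomogeneous 1 ha
    have m0 : GradedRing.proj 𝒜 0 a ∈ 𝒜 0 := SetLike.coe_mem _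
    have m1 : GradedRing.proj 𝒜 1 a ∈ 𝒜 1 := SetLike.coe_mem _
    have hs : GradedRing.proj 𝒜 0 a + GradedRing.proj 𝒜 1 a = a :=
      proj_add_proj 𝒜 a
    rw [← hs, add_mul]
    refine add_mem ?_ ?_
    · rw [even_comm' 𝒜 m0]
      exact I.toIdeal.mul_mem_left _ h0
    · obtain ⟨c, hc, d, hd, rfl⟩ := exists_add 𝒜 b
      rw [mul_add, ← even_comm' 𝒜 hc, odd_anticomm 𝒜 m1 hd]
      exact add_mem (I.toIdeal.mul_mem_left _ h1) (neg_mem (I.toIdeal.mul_mem_left _ h1))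

/-- A super-ring is Noetherian if its super-ideals satisfy the ascending chain condition. -/
def IsNoetherian : Prop := WellFoundedGT (HomogeneousIdeal 𝒜)

variable {𝒜} in
/-- A super-ideal `𝔭` is prime if `A ⧸ 𝔭` is an integral domain. (Commutativity of the quotient
is automatic, see `IsPrime.quotient_mul_comm`.) -/
def IsPrime (p : HomogeneousIdeal 𝒜) : Prop := IsDomain (A ⧸ p.toIdeal)

variable {𝒜} in
theorem IsPrime.quotient_mul_comm {p : HomogeneousIdeal 𝒜} (hp : IsPrime p)
    (x y : A ⧸ p.toIdeal) : x * y = y * x := by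
  have : IsDomain (A ⧸ p.toIdeal) := hp
  obtain ⟨x, rfl⟩ := Ideal.Quotient.mk_surjective x
  obtain ⟨y, rfl⟩ := Ideal.Quotient.mk_surjective y
  obtain ⟨a, ha, b, hb, rfl⟩ := exists_add 𝒜 x
  have hb0 : Ideal.Quotient.mk p.toIdeal b = 0 := by
    have h : Ideal.Quotient.mk p.toIdeal b * Ideal.Quotient.mk p.toIdeal b = 0 := by
      rw [← map_mul, odd_sq (𝒜 := 𝒜) b hb, map_zero]
    exact mul_self_eq_zero.mp h
  rw [map_add, hb0, add_zero, ← map_mul, ← map_mul, even_comm' 𝒜 ha]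

/-! ### Krull super-dimension -/

/-- The annihilator in `A₀` of an element `b` of `A`. -/
def evenAnn (b : A) : Ideal (evenPart 𝒜) where
  carrier := {r | (r : A) * b = 0}
  add_mem' {r s} hr hs := by
    change ((r : A) + (s : A)) * b = 0
    rw [add_mul, show (r : A) * b = 0 from hr, show (s : A) * b = 0 from hs, add_zero]
  zero_mem' := zero_mul b
  smul_mem' c r hr := by
    change ((c : A) * (r : A)) * b = 0
    rw [mul_assoc, show (r : A) * b = 0 from hr, mul_zero]

/-- Odd elements `y₁, …, y_s` form a system of odd parameters if
`Kdim (A₀) = Kdim (A₀ ⧸ Ann_{A₀} (y₁ ⋯ y_s))`. -/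
def IsSystemOfOddParameters {s : ℕ} (y : Fin s → 𝒜 1) : Prop :=
  ringKrullDim (evenPart 𝒜) =
    ringKrullDim (evenPart 𝒜 ⧸ evenAnn 𝒜 (List.ofFn fun i => (y i : A)).prod)

/-- The even Krull dimension: the Krull dimension of `A₀` (which is `⊥` for the zero ring). -/
noncomputable def Ksdim₀ : WithBot ℕ∞ := ringKrullDim (evenPart 𝒜)

/-- The odd Krull dimension: the largest length of a system of odd parameters. For the zero ring
it is `0` by convention. -/
noncomputable def Ksdim₁ : ℕ∞ :=
  ⨆ s ∈ {s : ℕ | Nontrivial A ∧ ∃ y : Fin s → 𝒜 1, IsSystemOfOddParameters 𝒜 y}, (s : ℕ∞)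

/-- The Krull super-dimension `Ksdim₀ | Ksdim₁`, an element of the set of super-dimension vectors
with its lexicographic order. -/
noncomputable def Ksdim : WithBot ℕ∞ ×ₗ ℕ∞ := toLex (Ksdim₀ 𝒜, Ksdim₁ 𝒜)

/-! ### Localization -/

section Localization

variable (S : Submonoid (evenPart 𝒜))

/-- The homogeneous components `S⁻¹A_i` of `S⁻¹A`, for a multiplicative subset `S` of `A₀`. -/
def localizationGrading (i : ZMod 2) : AddSubgroup (LocalizedModule S A) where
  carrier := {x | ∃ a ∈ 𝒜 i, ∃ s : S, x = LocalizedModule.mk a s}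
  add_mem' := by
    rintro _ _ ⟨a, ha, s, rfl⟩ ⟨b, hb, t, rfl⟩
    have hmul : ∀ (u : S) (c : A), c ∈ 𝒜 i → u • c ∈ 𝒜 i := by
      intro u c hc
      have h := SetLike.mul_mem_graded (A := 𝒜) (show ((u : evenPart 𝒜) : A) ∈ 𝒜 0 from u.1.2) hc
      rwa [zero_add] at h
    exact ⟨_, add_mem (hmul t a ha) (hmul s b hb), _, LocalizedModule.mk_add_mk⟩
  zero_mem' := ⟨0, zero_mem _, 1, (LocalizedModule.zero_mk 1).symm⟩
  neg_mem' := by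
    rintro _ ⟨a, ha, s, rfl⟩
    exact ⟨_, neg_mem ha, s, LocalizedModule.mk_neg.symm⟩

theorem localization_smul_mem {i : ZMod 2} {c : A} (u : S) (hc : c ∈ 𝒜 i) : u • c ∈ 𝒜 i := by
  have h := SetLike.mul_mem_graded (A := 𝒜) (show ((u : evenPart 𝒜) : A) ∈ 𝒜 0 from u.1.2) hc
  rwa [zero_add] at h

/-- `S⁻¹A` is again a super-ring. -/
noncomputable instance localizationSuperRing : SuperRing (localizationGrading 𝒜 S) :=
  { gradedRingOfSum (localizationGrading 𝒜 S)
      { one_mem := ⟨1, SetLike.one_mem_graded 𝒜, 1, by rw [OreLocalization.one_def]⟩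
        mul_mem := by
          rintro i j _ _ ⟨a, ha, s, rfl⟩ ⟨b, hb, t, rfl⟩
          exact ⟨_, SetLike.mul_mem_graded ha hb, _, LocalizedModule.mk_mul_mk⟩ }
      (by
        intro x
        induction x with | _ m s
        obtain ⟨a, ha, b, hb, rfl⟩ := exists_add 𝒜 m
        refine ⟨_, ⟨a, ha, s, rfl⟩, _, ⟨b, hb, s, rfl⟩, ?_⟩
        rw [LocalizedModule.mk_add_mk, LocalizedModule.mk_eq]
        exact ⟨1, by simp only [smul_add, smul_smul]⟩)
      (by
        rintro _ ⟨a, ha, s, rfl⟩ ⟨b, hb, t, hab⟩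
        obtain ⟨u, hu⟩ := LocalizedModule.mk_eq.mp hab
        have h0 : u • t • a ∈ 𝒜 0 :=
          localization_smul_mem 𝒜 S u (localization_smul_mem 𝒜 S t ha)
        have h1 : u • t • a ∈ 𝒜 1 := by
          rw [hu]; exact localization_smul_mem 𝒜 S u (localization_smul_mem 𝒜 S s hb)
        have h := eq_zero_of_mem_mem 𝒜 h0 h1
        rw [← LocalizedModule.zero_mk (1 : S), LocalizedModule.mk_eq]
        exact ⟨u * t, by rw [one_smul, smul_zero, smul_zero, mul_smul, h]⟩) with
    even_comm := by
      rintro _ ⟨a, ha, s, rfl⟩ i _ ⟨b, hb, t, rfl⟩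
      rw [LocalizedModule.mk_mul_mk, LocalizedModule.mk_mul_mk, even_comm' 𝒜 ha, mul_comm s t]
    odd_sq := by
      rintro _ ⟨a, ha, s, rfl⟩
      rw [LocalizedModule.mk_mul_mk, odd_sq (𝒜 := 𝒜) a ha, LocalizedModule.zero_mk] }

variable {𝒜} in
/-- The multiplicative subset `A₀ \ 𝔭₀` of `A₀`, for a prime super-ideal `𝔭`. -/
def primeCompl (p : HomogeneousIdeal 𝒜) (hp : IsPrime p) : Submonoid (evenPart 𝒜) where
  carrier := {r | (r : A) ∉ p.toIdeal}
  one_mem' h := by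
    have : IsDomain (A ⧸ p.toIdeal) := hp
    exact one_ne_zero (α := A ⧸ p.toIdeal)
      ((map_one _).symm.trans (Ideal.Quotient.eq_zero_iff_mem.mpr h))
  mul_mem' {r s} hr hs h := by
    have : IsDomain (A ⧸ p.toIdeal) := hp
    have h' := Ideal.Quotient.eq_zero_iff_mem.mpr
      (show (r : A) * (s : A) ∈ p.toIdeal from h)
    rw [map_mul, mul_eq_zero, Ideal.Quotient.eq_zero_iff_mem, Ideal.Quotient.eq_zero_iff_mem] at h'
    exact h'.elim hr hs

variable {𝒜} in
/-- The localization `A_𝔭 = (A₀ \ 𝔭₀)⁻¹ A` at a prime super-ideal, with its grading. -/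
def atPrimeGrading (p : HomogeneousIdeal 𝒜) (hp : IsPrime p) :
    ZMod 2 → AddSubgroup (LocalizedModule (primeCompl p hp) A) :=
  localizationGrading 𝒜 (primeCompl p hp)

variable {𝒜} in
noncomputable instance (p : HomogeneousIdeal 𝒜) (hp : IsPrime p) :
    SuperRing (atPrimeGrading p hp) :=
  localizationSuperRing 𝒜 (primeCompl p hp)

end Localization

/-! ### Completion -/

section Completion

variable {𝒜}
variable (I : HomogeneousIdeal 𝒜)

/-- The `I`-adic completion `lim A ⧸ Iⁿ`, as the subring of compatible families in
`∏ n, A ⧸ Iⁿ`. -/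
def completion : Subring (∀ n : ℕ, A ⧸ I.toIdeal ^ n) where
  carrier := {x | ∀ (m n : ℕ) (h : m ≤ n),
    Ideal.Quotient.factor (Ideal.pow_le_pow_right (I := I.toIdeal) h) (x n) = x m}
  mul_mem' {x y} hx hy m n h := by
    rw [Pi.mul_apply, Pi.mul_apply, map_mul, hx m n h, hy m n h]
  one_mem' m n h := by rw [Pi.one_apply, Pi.one_apply, map_one]
  add_mem' {x y} hx hy m n h := by
    rw [Pi.add_apply, Pi.add_apply, map_add, hx m n h, hy m n h]
  zero_mem' m n h := by rw [Pi.zero_apply, Pi.zero_apply, map_zero]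
  neg_mem' {x} hx m n h := by rw [Pi.neg_apply, Pi.neg_apply, map_neg, hx m n h]

/-- The homogeneous components of the completion: `Â_i` consists of the compatible families
all of whose terms are classes of elements of `A_i`. -/
def completionGrading (i : ZMod 2) : AddSubgroup (completion I) where
  carrier := {x | ∀ n, ∃ a ∈ 𝒜 i, Ideal.Quotient.mk (I.toIdeal ^ n) a = x.1 n}
  add_mem' {x y} hx hy n := by
    obtain ⟨a, ha, hax⟩ := hx n
    obtain ⟨b, hb, hby⟩ := hy n
    exact ⟨a + b, add_mem ha hb, by rw [map_add, hax, hby]; rfl⟩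
  zero_mem' n := ⟨0, zero_mem _, by rw [map_zero]; rfl⟩
  neg_mem' {x} hx n := by
    obtain ⟨a, ha, hax⟩ := hx n
    exact ⟨-a, neg_mem ha, by rw [map_neg, hax]; rfl⟩

/-- Powers of a super-ideal are homogeneous. -/
theorem proj_mem_pow (n : ℕ) (i : ZMod 2) {x : A} (hx : x ∈ I.toIdeal ^ n) :
    GradedRing.proj 𝒜 i x ∈ I.toIdeal ^ n := by
  have hmem : ∀ (k : ZMod 2) (z : A), z ∈ I.toIdeal ^ n → z ∈ 𝒜 k →
      GradedRing.proj 𝒜 i z ∈ I.toIdeal ^ n := by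
    intro k z hz hk
    by_cases h : k = i
    · subst h
      rw [GradedRing.proj_apply, DirectSum.decompose_of_mem_same 𝒜 hk]
      exact hz
    · rw [GradedRing.proj_apply, DirectSum.decompose_of_mem_ne 𝒜 hk h]
      exact zero_mem _
  have hs : ∀ a : A, GradedRing.proj 𝒜 0 a + GradedRing.proj 𝒜 1 a = a :=
    fun a => proj_add_proj 𝒜 a
  have hh : ∀ x ∈ I.toIdeal ^ n, ∃ a b : A, a ∈ 𝒜 0 ∧ a ∈ I.toIdeal ^ n ∧ b ∈ 𝒜 1 ∧
      b ∈ I.toIdeal ^ n ∧ a + b = x := by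
    clear hmem hx x
    induction n with
    | zero =>
      intro x _
      obtain ⟨a, ha, b, hb, h⟩ := exists_add 𝒜 x
      refine ⟨a, b, ha, ?_, hb, ?_, h⟩ <;>
      · rw [Submodule.pow_zero, Ideal.one_eq_top]; trivial
    | succ n ih =>
      intro x hx
      rw [Ideal.IsTwoSided.pow_succ] at hx ⊢
      refine Submodule.mul_induction_on hx ?_ ?_
      · intro a ha b hb
        obtain ⟨b0, b1, hb0, hb0', hb1, hb1', rfl⟩ := ih b hb
        have h0 : GradedRing.proj 𝒜 0 a ∈ I.toIdeal := I.isHomogeneous 0 ha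
        have h1 : GradedRing.proj 𝒜 1 a ∈ I.toIdeal := I.isHomogeneous 1 ha
        have m0 : GradedRing.proj 𝒜 0 a ∈ 𝒜 0 := SetLike.coe_mem _
        have m1 : GradedRing.proj 𝒜 1 a ∈ 𝒜 1 := SetLike.coe_mem _
        have e := hs a
        refine ⟨GradedRing.proj 𝒜 0 a * b0 + GradedRing.proj 𝒜 1 a * b1,
          GradedRing.proj 𝒜 0 a * b1 + GradedRing.proj 𝒜 1 a * b0, ?_, ?_, ?_, ?_, ?_⟩
        · exact add_mem (SetLike.mul_mem_graded (A := 𝒜) (i := 0) (j := 0) m0 hb0)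
            (SetLike.mul_mem_graded (A := 𝒜) (i := 1) (j := 1) m1 hb1)
        · exact add_mem (Ideal.mul_mem_mul h0 hb0') (Ideal.mul_mem_mul h1 hb1')
        · exact add_mem (SetLike.mul_mem_graded (A := 𝒜) (i := 0) (j := 1) m0 hb1)
            (SetLike.mul_mem_graded (A := 𝒜) (i := 1) (j := 0) m1 hb0)
        · exact add_mem (Ideal.mul_mem_mul h0 hb1') (Ideal.mul_mem_mul h1 hb0')
        · conv_rhs => rw [← e]
          noncomm_ring
      · rintro _ _ ⟨a, b, ha, ha', hb, hb', rfl⟩ ⟨c, d, hc, hc', hd, hd', rfl⟩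
        exact ⟨a + c, b + d, add_mem ha hc, add_mem ha' hc', add_mem hb hd, add_mem hb' hd',
          by abel⟩
  obtain ⟨a, b, ha, ha', hb, hb', rfl⟩ := hh x hx
  rw [map_add]
  exact add_mem (hmem 0 a ha' ha) (hmem 1 b hb' hb)

/-- The projection onto the component of parity `i`, induced on `A ⧸ Iⁿ`. -/
def quotientProj (n : ℕ) (i : ZMod 2) : (A ⧸ I.toIdeal ^ n) →+ (A ⧸ I.toIdeal ^ n) :=
  QuotientAddGroup.map _ _ (GradedRing.proj 𝒜 i) (fun _ hx => proj_mem_pow I n i hx)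

theorem quotientProj_mk (n : ℕ) (i : ZMod 2) (a : A) :
    quotientProj I n i (Ideal.Quotient.mk _ a) = Ideal.Quotient.mk _ (GradedRing.proj 𝒜 i a) :=
  rfl

/-- The `I`-adic completion is again a super-ring. -/
noncomputable instance completionSuperRing : SuperRing (completionGrading I) :=
  { gradedRingOfSum (completionGrading I)
      { one_mem := fun n => ⟨1, SetLike.one_mem_graded 𝒜, by rw [map_one]; rfl⟩
        mul_mem := by
          intro i j x y hx hy n
          obtain ⟨a, ha, hax⟩ := hx n
          obtain ⟨b, hb, hby⟩ := hy n
          exact ⟨a * b, SetLike.mul_mem_graded ha hb, by rw [map_mul, hax, hby]; rfl⟩ }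
      (by
        intro x
        have hc : ∀ i : ZMod 2, (fun n => quotientProj I n i (x.1 n)) ∈ completion I := by
          intro i m n h
          obtain ⟨a, ha⟩ := Ideal.Quotient.mk_surjective (x.1 n)
          have hx := x.2 m n h
          change Ideal.Quotient.factor _ (quotientProj I n i (x.1 n)) = quotientProj I m i (x.1 m)
          rw [← ha] at hx ⊢
          rw [← hx]
          rfl
        have hg : ∀ i : ZMod 2, (⟨_, hc i⟩ : completion I) ∈ completionGrading I i := by
          intro i n
          obtain ⟨a, ha⟩ := Ideal.Quotient.mk_surjective (x.1 n)
          refine ⟨GradedRing.proj 𝒜 i a, SetLike.coe_mem _, ?_⟩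
          change _ = quotientProj I n i (x.1 n)
          rw [← ha]
          rfl
        refine ⟨_, hg 0, _, hg 1, Subtype.ext (funext fun n => ?_)⟩
        change quotientProj I n 0 (x.1 n) + quotientProj I n 1 (x.1 n) = x.1 n
        obtain ⟨a, ha⟩ := Ideal.Quotient.mk_surjective (x.1 n)
        rw [← ha, quotientProj_mk, quotientProj_mk, ← map_add]
        congr 1
        exact proj_add_proj 𝒜 a)
      (by
        intro x h0 h1
        refine Subtype.ext (funext fun n => ?_)
        obtain ⟨a, ha, hax⟩ := h0 n
        obtain ⟨b, hb, hbx⟩ := h1 n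
        have ea : quotientProj I n 0 (x.1 n) = x.1 n := by
          rw [← hax, quotientProj_mk, GradedRing.proj_apply,
            DirectSum.decompose_of_mem_same 𝒜 ha]
        have eb : quotientProj I n 0 (x.1 n) = 0 := by
          rw [← hbx, quotientProj_mk, GradedRing.proj_apply,
            DirectSum.decompose_of_mem_ne 𝒜 hb (by decide), map_zero]
        rw [← ea, eb]
        rfl) with
    even_comm := by
      intro x hx i y hy
      refine Subtype.ext (funext fun n => ?_)
      obtain ⟨a, ha, hax⟩ := hx n
      obtain ⟨b, hb, hby⟩ := hy n
      change x.1 n * y.1 n = y.1 n * x.1 n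
      rw [← hax, ← hby, ← map_mul, ← map_mul, even_comm' 𝒜 ha]
    odd_sq := by
      intro x hx
      refine Subtype.ext (funext fun n => ?_)
      obtain ⟨a, ha, hax⟩ := hx n
      change x.1 n * x.1 n = 0
      rw [← hax, ← map_mul, odd_sq (𝒜 := 𝒜) a ha, map_zero] }

end Completion

end SuperRing

/-! ### Adic completions of Noetherian commutative rings. -/

section CommutativeAlgebra

open AdicCompletion

universe u

/-! Everything is reduced to chains of primes of even parts. If `A₀` has finite dimension `n`, odd
elements with product `y` form a system of odd parameters exactly when some chain of primes of
length `n` starts above `Ann(y)`. The relation `HasOddChain n s` (some `s` odd elements and some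
chain of length `n` starting above the annihilator of their product) therefore determines a finite
super-dimension, and the theorem follows from `hasOddChain_completion_iff`: the completion satisfies
the relation for `(n, s)` exactly when some `A_𝔭` with `𝔭 ⊇ I` does. For `A_𝔭` the relation asks for
a chain in `A₀` ending inside `𝔭₀`.

Write `R = A₀` and `J = I ∩ A₀`. `R` is Noetherian and `A` is finite over it. Products of two odd
elements are nilpotent, so the `I`-adic and `J`-adic topologies on `A` agree; hence the even part of
the completion is the `J`-adic completion `R̂`, and the completion of `A` is `R̂ ⊗ A`.

From `A_𝔭` to the completion: `R̂` is flat over `R`, so going down lifts a chain below a prime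
containing `J`, and flatness makes the annihilator of `y` in `R̂` the extension of the one in `R`.

From the completion to some `A_𝔭`: choose a maximal ideal `M` above the chain. It contains `J` and
is extended from its contraction `m`, so by Krull's height theorem the height of `M` modulo the
bottom prime `P` is at most that of `m` modulo `P ∩ R`. This yields an equally long chain in `R`
starting above `P ∩ R`. The odd elements of the completion are sums of products `t * b` with `t ∈
R̂` and `b ∈ A₁`; since `P` is prime, one such `b` can replace each factor while the annihilator of
the product stays in `P`. -/

theorem AdicCompletion.isNoetherianRing {R : Type*} [CommRing R] [IsNoetherianRing R]
    (J : Ideal R) : IsNoetherianRing (AdicCompletion J R) := by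
  obtain ⟨k, a, ha⟩ := Submodule.fg_iff_exists_fin_generating_family.mp
    (IsNoetherian.noetherian J)
  -- Sending the variables to generators of `J` makes the completion of `R` a quotient of the power
  -- series ring, which is Noetherian. Constants already cover everything modulo `J`, and
  -- completeness upgrades this to surjectivity.
  let ev : MvPolynomial (Fin k) R →+* R := MvPolynomial.eval a
  have hevX : ∀ i, ev (MvPolynomial.X i) = a i := fun i => MvPolynomial.eval_X i
  have hevC : ∀ r, ev (MvPolynomial.C r) = r := fun r => MvPolynomial.eval_C r
  have hev : (MvPolynomial.idealOfVars (Fin k) R).map ev = J := by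
    rw [MvPolynomial.idealOfVars, Ideal.map_span, ← Set.range_comp]
    convert ha using 3
    ext i; simp [hevX]
  let X := MvPolynomial.idealOfVars (Fin k) R
  have hle : ∀ n, X ^ n ≤ (J ^ n).comap ev := fun n => by
    rw [← Ideal.map_le_iff_le_comap, Ideal.map_pow, hev]
  let f : ∀ n : ℕ, AdicCompletion X (MvPolynomial (Fin k) R) →+* R ⧸ J ^ n := fun n =>
    (Ideal.quotientMap (J ^ n) ev (hle n)).comp
      (evalₐ X n : AdicCompletion X (MvPolynomial (Fin k) R) →+* _)
  have hf : ∀ {m n : ℕ} (h : m ≤ n), (Ideal.Quotient.factorPow J h).comp (f n) = f m := by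
    intro m n h
    ext x
    obtain ⟨x, rfl⟩ := AdicCompletion.mk_surjective X (MvPolynomial (Fin k) R) x
    have h1 : (Ideal.Quotient.mk (X ^ m)) (x.val n) = Ideal.Quotient.mk (X ^ m) (x.val m) :=
      AdicCompletion.Ideal.mk_eq_mk X h x
    have h2 := congrArg (Ideal.quotientMap (J ^ m) ev (hle m)) h1
    exact h2
  let g : MvPowerSeries (Fin k) R →+* AdicCompletion J R :=
    (liftRingHom J f hf).comp
      (MvPowerSeries.toAdicCompletionAlgEquiv (Fin k) R : MvPowerSeries (Fin k) R →+* _)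
  have hg : ∀ p : MvPolynomial (Fin k) R,
      g (p : MvPowerSeries (Fin k) R) = algebraMap R _ (ev p) := by
    intro p
    refine ext_evalₐ (I := J) fun n => ?_
    have h : (MvPowerSeries.toAdicCompletionAlgEquiv (Fin k) R) (p : MvPowerSeries (Fin k) R)
        = of X (MvPolynomial (Fin k) R) p := by
      simp [MvPowerSeries.toAdicCompletion_coe, X]
    refine (evalₐ_liftRingHom J f hf n _).trans ?_
    change Ideal.quotientMap (J ^ n) ev (hle n) (evalₐ X n
      ((MvPowerSeries.toAdicCompletionAlgEquiv (Fin k) R) (p : MvPowerSeries (Fin k) R))) = _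
    rw [h, evalₐ_of, Ideal.quotientMap_mk]
    exact (evalₐ_of J n (ev p)).symm
  have hX : (Ideal.span (Set.range MvPowerSeries.X) : Ideal (MvPowerSeries (Fin k) R)).map g
      = J.map (algebraMap R (AdicCompletion J R)) := by
    have ha' : Ideal.span (Set.range a) = J := ha
    conv_rhs => enter [2]; rw [← ha']
    rw [Ideal.map_span, ← Set.range_comp, Ideal.map_span, ← Set.range_comp]
    congr 2
    ext1 i
    rw [Function.comp_apply, ← MvPolynomial.coe_X, hg, hevX]; rfl
  have hJ : J.FG := IsNoetherian.noetherian J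
  have : IsHausdorff ((Ideal.span (Set.range MvPowerSeries.X) :
      Ideal (MvPowerSeries (Fin k) R)).map g) (AdicCompletion J R) := by
    rw [hX]
    exact (isAdicComplete_self J hJ).toIsHausdorff
  refine isNoetherianRing_of_surjective _ _ g
    (surjective_of_mk_map_comp_surjective (I := Ideal.span (Set.range MvPowerSeries.X)) g ?_)
  intro y
  obtain ⟨y, rfl⟩ := Ideal.Quotient.mk_surjective y
  obtain ⟨r, hr⟩ := Ideal.Quotient.mk_surjective (evalOneₐ J y)
  refine ⟨((MvPolynomial.C r : MvPolynomial (Fin k) R) : MvPowerSeries (Fin k) R), ?_⟩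
  rw [RingHom.comp_apply, hg, hevC, Ideal.Quotient.eq, hX, ← ker_evalOneₐ_eq_map J hJ]
  change evalOneₐ J _ = 0
  rw [map_sub, ← hr, sub_eq_zero]
  rfl

/-- Lower bounds for the dimension of a quotient ring, in terms of chains of primes. -/
theorem le_ringKrullDim_quotient_iff {B : Type*} [CommRing B] (b : Ideal B) (n : ℕ) :
    (n : WithBot ℕ∞) ≤ ringKrullDim (B ⧸ b) ↔
      ∃ l : LTSeries (PrimeSpectrum B), l.length = n ∧ b ≤ l.head.asIdeal := by
  rw [ringKrullDim_quotient, Order.le_krullDim_iff]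
  constructor
  · rintro ⟨l, hl⟩
    refine ⟨l.map Subtype.val (fun _ _ h => h), hl, ?_⟩
    exact l.head.2
  · rintro ⟨l, hl, hb⟩
    have hmem : ∀ i, l i ∈ PrimeSpectrum.zeroLocus (b : Set B) := fun i =>
      hb.trans (l.head_le i)
    exact ⟨⟨l.length, fun i => ⟨l i, hmem i⟩, fun i => l.step i⟩, hl⟩

theorem exists_ltSeries_of_le_height {R : Type*} [CommRing R] (p : Ideal R) [hp : p.IsPrime]
    (n : ℕ) (h : n ≤ p.height) :
    ∃ l : LTSeries (PrimeSpectrum R), l.length = n ∧ l.last.asIdeal = p := by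
  have h' : (n : ℕ∞) ≤ Order.height (⟨p, hp⟩ : PrimeSpectrum R) := by
    rwa [← PrimeSpectrum.height_eq_orderHeight]
  obtain ⟨l, hl, hn⟩ := Order.exists_series_of_le_height _ h'
  exact ⟨l, hn, by rw [hl]⟩

theorem length_le_height {R : Type*} [CommRing R] {p : Ideal R} [hp : p.IsPrime]
    (l : LTSeries (PrimeSpectrum R)) (h : l.last.asIdeal ≤ p) : l.length ≤ p.height := by
  have := Order.length_le_height (x := (⟨p, hp⟩ : PrimeSpectrum R)) (p := l) h
  rwa [← PrimeSpectrum.height_eq_orderHeight] at this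

/-- The height of a prime does not exceed that of its contraction, if it is extended from its
contraction. -/
theorem height_le_height_comap {R S : Type*} [CommRing R] [CommRing S] [IsNoetherianRing R]
    [IsNoetherianRing S] (f : R →+* S) (M : Ideal S) [M.IsPrime] (hM : M ≤ (M.comap f).map f) :
    M.height ≤ (M.comap f).height := by
  -- The contraction is minimal over as many elements as its height; `M`, being extended, is minimal
  -- over their images, so Krull's height theorem applies.
  obtain ⟨s, hs, hcard⟩ := (M.comap f).exists_finset_card_eq_height_of_isNoetherianRing
  classical
  rw [← hcard]
  refine (Ideal.height_le_card_of_mem_minimalPrimes_span_finset (s := s.image f) ?_).trans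
    (by exact_mod_cast Finset.card_image_le)
  rw [Finset.coe_image, ← Ideal.map_span]
  refine ⟨⟨inferInstance, Ideal.map_le_iff_le_comap.mpr hs.1.2⟩, fun P hP hPM => ?_⟩
  have hPp : P.IsPrime := hP.1
  refine hM.trans (Ideal.map_le_iff_le_comap.mpr ?_)
  exact hs.2 ⟨inferInstance, Ideal.map_le_iff_le_comap.mp hP.2⟩ (Ideal.comap_mono hPM)

/-! ### Chains of primes and annihilators in an adic completion. -/

section

variable {R : Type u} [CommRing R] [IsNoetherianRing R] (J : Ideal R)

/-- The preimage of `p / J` under the projection of the completion to `R / J` is a prime over `p`;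
flatness gives going down from there. -/
theorem exists_ltSeries_adicCompletion (p : Ideal R) [p.IsPrime] (hJ : J ≤ p)
    (l : LTSeries (PrimeSpectrum R)) (hl : l.last.asIdeal ≤ p) :
    ∃ L : LTSeries (PrimeSpectrum (AdicCompletion J R)), L.length = l.length ∧
      L.head.asIdeal.comap (algebraMap R _) = l.head.asIdeal := by
  let ev := (evalOneₐ J).toRingHom
  have hpm : (p.map (Ideal.Quotient.mk J)).IsPrime :=
    Ideal.map_isPrime_of_surjective Ideal.Quotient.mk_surjective (by simpa using hJ)
  let Q : Ideal (AdicCompletion J R) := (p.map (Ideal.Quotient.mk J)).comap ev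
  have hQ : Q.IsPrime := Ideal.comap_isPrime _ _
  have hQp : Q.LiesOver p := ⟨by
    rw [Ideal.under_def, Ideal.comap_comap]
    change _ = Ideal.comap (Ideal.Quotient.mk J) _
    rw [Ideal.comap_map_of_surjective' _ Ideal.Quotient.mk_surjective, Ideal.mk_ker,
      sup_eq_left.mpr hJ]⟩
  obtain ⟨Q', -, hQ', hQl⟩ := Ideal.exists_ideal_le_liesOver_of_le Q hl
  obtain ⟨L, hlen, -, hmap⟩ := Ideal.exists_ltSeries_of_hasGoingDown l Q'
  refine ⟨L, hlen, ?_⟩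
  -- Going down returns the lift as an equality of lists, whose first entries are compared here.
  have h : l.toList[0]'(by simp [RelSeries.length_toList]) =
      (PrimeSpectrum.comap (algebraMap R _)) (L.toList[0]'(by simp [RelSeries.length_toList])) := by
    rw [List.getElem_map_rev (PrimeSpectrum.comap (algebraMap R _)),
      List.getElem_of_eq hmap.symm _]
  rw [RelSeries.toList_getElem_zero_eq_head, RelSeries.toList_getElem_zero_eq_head] at h
  rw [h]; rfl

/-- Completeness puts the extension of `J` in the Jacobson radical, and modulo that extension every
element of the completion comes from `R`. -/
theorem le_comap_and_le_map_of_isMaximal (M : Ideal (AdicCompletion J R)) [hM : M.IsMaximal] :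
    J ≤ M.comap (algebraMap R _) ∧
      M ≤ (M.comap (algebraMap R (AdicCompletion J R))).map (algebraMap R _) := by
  have hJ : J.FG := IsNoetherian.noetherian J
  have := isAdicComplete_self J hJ
  have hJM : J.map (algebraMap R (AdicCompletion J R)) ≤ M :=
    (IsAdicComplete.le_jacobson_bot _).trans (sInf_le ⟨bot_le, hM⟩)
  have hJM' : J ≤ M.comap (algebraMap R _) := Ideal.map_le_iff_le_comap.mp hJM
  refine ⟨hJM', fun x hx => ?_⟩
  obtain ⟨r, hr⟩ := Ideal.Quotient.mk_surjective (evalOneₐ J x)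
  have hxr : x - algebraMap R _ r ∈ J.map (algebraMap R (AdicCompletion J R)) := by
    rw [← ker_evalOneₐ_eq_map J hJ]
    change evalOneₐ J _ = 0
    rw [map_sub, ← hr, sub_eq_zero]
    rfl
  have hrM : r ∈ M.comap (algebraMap R _) := by
    have := sub_mem hx (hJM hxr)
    rwa [sub_sub_cancel] at this
  have := add_mem (Ideal.map_mono hJM' hxr) (Ideal.mem_map_of_mem (algebraMap R _) hrM)
  rwa [sub_add_cancel] at this

/-- Contracting the chain itself could make primes coincide, so only its length is kept: it bounds a
height from below, and a new chain in `R` is extracted from the corresponding height there. -/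
theorem exists_ltSeries_of_adicCompletion (L : LTSeries (PrimeSpectrum (AdicCompletion J R))) :
    ∃ p : Ideal R, p.IsPrime ∧ J ≤ p ∧ ∃ l : LTSeries (PrimeSpectrum R), l.length = L.length ∧
      l.last.asIdeal ≤ p ∧ L.head.asIdeal.comap (algebraMap R _) ≤ l.head.asIdeal := by
  have := AdicCompletion.isNoetherianRing J
  obtain ⟨M, hM, hLM⟩ := L.last.asIdeal.exists_le_maximal L.last.2.ne_top
  obtain ⟨hJM, hMM⟩ := le_comap_and_le_map_of_isMaximal J M
  let φ := algebraMap R (AdicCompletion J R)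
  let P := L.head.asIdeal
  let a := P.comap φ
  have hPM : P ≤ M := le_trans (L.head_le_last) hLM
  -- After dividing by the bottom prime, any chain found downstairs automatically starts above its
  -- contraction `a`.
  let f : R ⧸ a →+* AdicCompletion J R ⧸ P := Ideal.quotientMap P φ le_rfl
  let M' := M.map (Ideal.Quotient.mk P)
  have hM' : M'.IsPrime :=
    Ideal.map_isPrime_of_surjective Ideal.Quotient.mk_surjective (by simpa using hPM)
  have hcomap : (M'.comap f).comap (Ideal.Quotient.mk a) = M.comap φ := by
    rw [Ideal.comap_comap]
    have : f.comp (Ideal.Quotient.mk a) = (Ideal.Quotient.mk P).comp φ :=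
      RingHom.ext fun r => rfl
    rw [this, ← Ideal.comap_comap, Ideal.comap_map_of_surjective' _ Ideal.Quotient.mk_surjective,
      Ideal.mk_ker, sup_eq_left.mpr hPM]
  have hM'f : M' ≤ (M'.comap f).map f := by
    refine Ideal.map_le_iff_le_comap.mpr (hMM.trans (Ideal.map_le_iff_le_comap.mpr fun r hr => ?_))
    have hr' : r ∈ (M'.comap f).comap (Ideal.Quotient.mk a) := by rw [hcomap]; exact hr
    exact Ideal.mem_map_of_mem f (Ideal.mem_comap.mp hr')
  have hmem : ∀ i, L i ∈ PrimeSpectrum.zeroLocus (P : Set (AdicCompletion J R)) :=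
    fun i => L.head_le i
  let e := P.primeSpectrumQuotientOrderIsoZeroLocus
  let L' : LTSeries (PrimeSpectrum (AdicCompletion J R ⧸ P)) :=
    ⟨L.length, fun i => e.symm ⟨L i, hmem i⟩, fun i => e.symm.strictMono (L.step i)⟩
  have hL' : L'.last.asIdeal ≤ M' := by
    have h : (e L'.last).1.asIdeal ≤ M := by
      have : e L'.last = ⟨L.last, hmem _⟩ := e.apply_symm_apply _
      rw [this]; exact hLM
    have h2 := Ideal.map_mono (f := Ideal.Quotient.mk P) h
    rwa [show (e L'.last).1.asIdeal = L'.last.asIdeal.comap (Ideal.Quotient.mk P) from rfl,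
      Ideal.map_comap_of_surjective _ Ideal.Quotient.mk_surjective] at h2
  have hn := (length_le_height L' hL').trans (height_le_height_comap f M' hM'f)
  obtain ⟨l, hl, hlast⟩ := exists_ltSeries_of_le_height _ _ hn
  refine ⟨M.comap φ, inferInstance, hJM,
    l.map (PrimeSpectrum.comap (Ideal.Quotient.mk a))
      (RingHom.strictMono_comap_of_surjective Ideal.Quotient.mk_surjective), hl, ?_, ?_⟩
  · rw [LTSeries.last_map, PrimeSpectrum.comap_asIdeal, hlast, hcomap]
  · rw [LTSeries.head_map, PrimeSpectrum.comap_asIdeal]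
    intro r hr
    rw [Ideal.mem_comap, Ideal.Quotient.eq_zero_iff_mem.mpr hr]
    exact zero_mem _

/-- For finite `M` the completion is a base change, and flatness preserves exactness of `Ann(y) → R
→ M`. Hence annihilators in the completion are extended from `R`. -/
theorem mem_map_of_smul_of_eq_zero {M : Type u} [AddCommGroup M] [Module R M] [Module.Finite R M]
    (a : Ideal R) (y : M) (ha : ∀ r : R, r • y = 0 → r ∈ a) (t : AdicCompletion J R)
    (ht : t • of J M y = 0) : t ∈ a.map (algebraMap R (AdicCompletion J R)) := by
  have h0 : t ⊗ₜ[R] y = 0 := by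
    apply (ofTensorProduct_bijective_of_finite_of_isNoetherian J M).injective
    rw [ofTensorProduct_tmul, ht, _root_.map_zero]
  let k := LinearMap.ker (LinearMap.toSpanSingleton R M y)
  have hex : Function.Exact k.subtype (LinearMap.toSpanSingleton R M y) :=
    LinearMap.exact_subtype_ker_map _
  have hex' := Module.Flat.lTensor_exact (AdicCompletion J R) hex
  obtain ⟨z, hz⟩ := (hex' (t ⊗ₜ 1)).mp (by simpa using h0)
  have hall : ∀ z : TensorProduct R (AdicCompletion J R) k,
      TensorProduct.rid R _ (k.subtype.lTensor (AdicCompletion J R) z)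
        ∈ a.map (algebraMap R (AdicCompletion J R)) := by
    intro z
    induction z with
    | zero => simp
    | add x y hx hy => rw [map_add, map_add]; exact add_mem hx hy
    | tmul s r =>
      rw [LinearMap.lTensor_tmul, TensorProduct.rid_tmul, Algebra.smul_def]
      exact Ideal.mul_mem_right _ _ (Ideal.mem_map_of_mem _ (ha _ r.2))
  have := hall z
  rwa [hz, TensorProduct.rid_tmul, one_smul] at this

end

end CommutativeAlgebra

namespace SuperRing

open AdicCompletion

/-! ### Finiteness over the even part. -/

section Noetherian

variable {A : Type*} [Ring A] (𝒜 : ZMod 2 → AddSubgroup A) [SuperRing 𝒜]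

theorem proj_mem (i : ZMod 2) (x : A) : GradedRing.proj 𝒜 i x ∈ 𝒜 i := SetLike.coe_mem _

theorem proj_of_mem {i : ZMod 2} {x : A} (hx : x ∈ 𝒜 i) : GradedRing.proj 𝒜 i x = x :=
  DirectSum.decompose_of_mem_same 𝒜 hx

theorem proj_of_mem_ne {i j : ZMod 2} (hij : i ≠ j) {x : A} (hx : x ∈ 𝒜 i) :
    GradedRing.proj 𝒜 j x = 0 :=
  DirectSum.decompose_of_mem_ne 𝒜 hx hij

theorem proj_mul_of_mem {i : ZMod 2} (a : A) {x : A} (hx : x ∈ 𝒜 i) :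
    GradedRing.proj 𝒜 i (a * x) = GradedRing.proj 𝒜 0 a * x := by
  have h0 := SetLike.mul_mem_graded (A := 𝒜) (proj_mem 𝒜 0 a) hx
  have h1 := SetLike.mul_mem_graded (A := 𝒜) (proj_mem 𝒜 1 a) hx
  conv_lhs => rw [← proj_add_proj 𝒜 a, add_mul, map_add]
  rw [zero_add] at h0
  rw [proj_of_mem 𝒜 h0, proj_of_mem_ne 𝒜 ((by decide : ∀ k : ZMod 2, 1 + k ≠ k) i) h1, add_zero]

theorem smul_mem_component {i : ZMod 2} (r : evenPart 𝒜) {x : A} (hx : x ∈ 𝒜 i) :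
    r • x ∈ 𝒜 i := by
  have h := SetLike.mul_mem_graded (A := 𝒜) (show (r : A) ∈ 𝒜 0 from r.2) hx
  rwa [zero_add] at h

/-- The homogeneous components as submodules over the even part. -/
def component (i : ZMod 2) : Submodule (evenPart 𝒜) A where
  carrier := 𝒜 i
  add_mem' := add_mem
  zero_mem' := zero_mem _
  smul_mem' r _ hx := smul_mem_component 𝒜 r hx

/-- The super-ideal generated by a submodule of a homogeneous component. -/
def spanComponent (i : ZMod 2) (N : Submodule (evenPart 𝒜) (component 𝒜 i)) :
    HomogeneousIdeal 𝒜 where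
  toSubmodule := Ideal.span ((N.map (component 𝒜 i).subtype : Submodule _ A) : Set A)
  is_homogeneous' := Ideal.homogeneous_span 𝒜 _ (by
    rintro _ ⟨x, -, rfl⟩
    exact ⟨i, x.2⟩)

/-- For `x` of parity `i`, the parity `i` part of `a * x` is `a₀ * x`, which uses only even scalars.
Quantifying over the left factor `a` lets the span induction close. -/
theorem proj_mem_of_mem_span {i : ZMod 2} (N : Submodule (evenPart 𝒜) A)
    (hN : ∀ x ∈ N, x ∈ 𝒜 i) {x : A} (hx : x ∈ Ideal.span (N : Set A)) :
    GradedRing.proj 𝒜 i x ∈ N := by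
  suffices h : ∀ a : A, GradedRing.proj 𝒜 i (a * x) ∈ N by simpa using h 1
  induction hx using Submodule.span_induction with
  | mem x hx =>
    intro a
    rw [proj_mul_of_mem 𝒜 a (hN x hx)]
    exact N.smul_mem ⟨_, proj_mem 𝒜 0 a⟩ hx
  | zero => simp
  | add x y _ _ hx hy => intro a; rw [mul_add, map_add]; exact add_mem (hx a) (hy a)
  | smul b x _ hx => intro a; rw [smul_eq_mul, ← mul_assoc]; exact hx _

/-- A submodule is recovered as the parity `i` part of the super-ideal it generates, so the chain
condition descends from super-ideals to each component. -/
theorem spanComponent_strictMono (i : ZMod 2) : StrictMono (spanComponent 𝒜 i) := by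
  have key : ∀ N : Submodule (evenPart 𝒜) (component 𝒜 i), ∀ x : component 𝒜 i,
      (x : A) ∈ (spanComponent 𝒜 i N).toIdeal → x ∈ N := by
    intro N x hx
    have h := proj_mem_of_mem_span 𝒜 (i := i) (N.map (component 𝒜 i).subtype)
      (by rintro _ ⟨y, -, rfl⟩; exact y.2) hx
    rw [proj_of_mem 𝒜 x.2] at h
    obtain ⟨y, hy, hyx⟩ := h
    rwa [← Subtype.ext hyx]
  refine Monotone.strictMono_of_injective (fun N N' h => ?_) fun N N' h => ?_
  · change Ideal.span _ ≤ Ideal.span _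
    exact Ideal.span_mono (Submodule.map_mono h)
  · refine le_antisymm (fun x hx => key N' x ?_) (fun x hx => key N x ?_)
    · rw [← h]; exact Ideal.subset_span ⟨x, hx, rfl⟩
    · rw [h]; exact Ideal.subset_span ⟨x, hx, rfl⟩

variable {𝒜} (hN : IsNoetherian 𝒜)
include hN

theorem IsNoetherian.component (i : ZMod 2) : _root_.IsNoetherian (evenPart 𝒜) (component 𝒜 i) :=
  have : WellFoundedGT (HomogeneousIdeal 𝒜) := hN
  isNoetherian_iff'.mpr (spanComponent_strictMono 𝒜 i).wellFoundedGT

theorem IsNoetherian.evenPart : IsNoetherianRing (evenPart 𝒜) := by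
  have := hN.component 0
  refine isNoetherian_of_injective
    ((Algebra.linearMap (SuperRing.evenPart 𝒜) A).codRestrict (SuperRing.component 𝒜 0)
      fun r => r.2) fun r s h => ?_
  exact Subtype.ext (congrArg (Subtype.val : SuperRing.component 𝒜 0 → A) h)

theorem IsNoetherian.finite : Module.Finite (SuperRing.evenPart 𝒜) A := by
  have := hN.component 0
  have := hN.component 1
  have : _root_.IsNoetherian (SuperRing.evenPart 𝒜) A := by
    refine isNoetherian_of_surjective (f :=
      (SuperRing.component 𝒜 0).subtype.coprod (SuperRing.component 𝒜 1).subtype) ?_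
    rw [LinearMap.range_eq_top]
    intro x
    obtain ⟨a, ha, b, hb, rfl⟩ := exists_add 𝒜 x
    exact ⟨(⟨a, ha⟩, ⟨b, hb⟩), rfl⟩
  infer_instance

end Noetherian

/-! ### Comparison of the adic topologies of `I` and of its even part. -/

section Topology

variable {A : Type*} [Ring A] {𝒜 : ZMod 2 → AddSubgroup A} [SuperRing 𝒜]
variable (I : HomogeneousIdeal 𝒜)

/-- The even part of a super-ideal. -/
def evenIdeal : Ideal (evenPart 𝒜) := I.toIdeal.comap (algebraMap (evenPart 𝒜) A)

theorem mul_odd_mem_evenPart {s t : A} (hs : s ∈ 𝒜 1) (ht : t ∈ 𝒜 1) : s * t ∈ evenPart 𝒜 :=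
  SetLike.mul_mem_graded (A := 𝒜) (i := 1) (j := 1) hs ht

/-- Anticommuting the middle factors turns `stst` into `-(s²t²) = 0`. -/
theorem mul_odd_mem_nilradical {s t : A} (hs : s ∈ 𝒜 1) (ht : t ∈ 𝒜 1) :
    (⟨s * t, mul_odd_mem_evenPart hs ht⟩ : evenPart 𝒜) ∈ nilradical (evenPart 𝒜) := by
  refine ⟨2, Subtype.ext ?_⟩
  change (s * t) ^ 2 = 0
  rw [pow_two, mul_assoc, ← mul_assoc t s t, odd_anticomm 𝒜 ht hs, neg_mul, mul_assoc s t t,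
    odd_sq (𝒜 := 𝒜) t ht, mul_zero, neg_zero, mul_zero]

theorem mul_mem_smul_top {K L : Ideal (evenPart 𝒜)} {x y : A}
    (hx : x ∈ K • (⊤ : Submodule (evenPart 𝒜) A)) (hy : y ∈ L • (⊤ : Submodule (evenPart 𝒜) A)) :
    x * y ∈ (K * L) • (⊤ : Submodule (evenPart 𝒜) A) := by
  induction hx using Submodule.smul_induction_on' with
  | add x _ x' _ h h' => rw [add_mul]; exact add_mem h h'
  | smul r hr a _ =>
    induction hy using Submodule.smul_induction_on' with
    | add y _ y' _ h h' => rw [mul_add]; exact add_mem h h'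
    | smul s hs b _ =>
      rw [smul_mul_assoc, mul_smul_comm, smul_smul]
      exact Submodule.smul_mem_smul (Ideal.mul_mem_mul hr hs) trivial

theorem mul_mem_sup_nilradical_smul_top {x y : A} (hx : x ∈ I.toIdeal) (hy : y ∈ I.toIdeal) :
    x * y ∈ (evenIdeal I ⊔ nilradical (evenPart 𝒜)) • (⊤ : Submodule (evenPart 𝒜) A) := by
  have h0 : ∀ {x : A}, x ∈ I.toIdeal → ∀ b : A, GradedRing.proj 𝒜 0 x * b ∈
      (evenIdeal I ⊔ nilradical (evenPart 𝒜)) • (⊤ : Submodule (evenPart 𝒜) A) := by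
    intro x hx b
    exact Submodule.smul_mem_smul (r := (⟨_, proj_mem 𝒜 0 x⟩ : evenPart 𝒜)) (n := b)
      (Ideal.mem_sup_left (I.isHomogeneous 0 hx)) trivial
  have e : x * y = GradedRing.proj 𝒜 0 x * y + GradedRing.proj 𝒜 0 y * GradedRing.proj 𝒜 1 x
      + GradedRing.proj 𝒜 1 x * GradedRing.proj 𝒜 1 y * 1 := by
    rw [even_comm' 𝒜 (proj_mem 𝒜 0 y), mul_one, add_assoc, ← mul_add, proj_add_proj, ← add_mul,
      proj_add_proj]
  rw [e]
  refine add_mem (add_mem (h0 hx _) (h0 hy _)) ?_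
  exact Submodule.smul_mem_smul
    (r := (⟨_, mul_odd_mem_evenPart (proj_mem 𝒜 1 x) (proj_mem 𝒜 1 y)⟩ : evenPart 𝒜))
    (Ideal.mem_sup_right (mul_odd_mem_nilradical (proj_mem 𝒜 1 x) (proj_mem 𝒜 1 y))) trivial

/-- Each pair of factors from `I` yields one factor from `I₀` plus the nilradical, whence the
exponent `2 * n`. -/
theorem mem_smul_top_of_mem_pow (n : ℕ) {x : A} (hx : x ∈ I.toIdeal ^ (2 * n)) :
    x ∈ (evenIdeal I ⊔ nilradical (evenPart 𝒜)) ^ n • (⊤ : Submodule (evenPart 𝒜) A) := by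
  induction n generalizing x with
  | zero => simp
  | succ n ih =>
    rw [show 2 * (n + 1) = 2 * n + 1 + 1 by ring, Ideal.IsTwoSided.pow_succ,
      Ideal.IsTwoSided.pow_succ, ← mul_assoc] at hx
    induction hx using Submodule.mul_induction_on' with
    | add x _ y _ h h' => exact add_mem h h'
    | mem_mul_mem a ha b hb =>
      rw [pow_succ']
      refine mul_mem_smul_top ?_ (ih hb)
      induction ha using Submodule.mul_induction_on' with
      | add x _ y _ h h' => exact add_mem h h'
      | mem_mul_mem a ha b hb => exact mul_mem_sup_nilradical_smul_top I ha hb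

/-- The nilradical of the Noetherian ring `A₀` has vanishing `k`-th power, so `k` extra factors of
`I₀` plus nilradical leave only `I₀ ^ n`. -/
theorem exists_pow_le_smul_top (hN : IsNoetherian 𝒜) : ∃ k : ℕ, ∀ n : ℕ,
    ∀ x ∈ I.toIdeal ^ (2 * (n + k)), x ∈ evenIdeal I ^ n • (⊤ : Submodule (evenPart 𝒜) A) := by
  have := hN.evenPart
  obtain ⟨k, hk⟩ := IsNoetherianRing.isNilpotent_nilradical (evenPart 𝒜)
  refine ⟨k, fun n x hx => ?_⟩
  have hle := Ideal.sup_pow_add_le_pow_sup_pow (I := evenIdeal I)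
    (J := nilradical (evenPart 𝒜)) (n := n) (m := k)
  rw [hk, Ideal.zero_eq_bot, sup_bot_eq] at hle
  exact Submodule.smul_mono_left hle (mem_smul_top_of_mem_pow I _ hx)

theorem coe_mem_pow (n : ℕ) {r : evenPart 𝒜} (hr : r ∈ evenIdeal I ^ n) :
    (r : A) ∈ I.toIdeal ^ n := by
  induction n generalizing r with
  | zero => rw [Submodule.pow_zero, Ideal.one_eq_top]; trivial
  | succ n ih =>
    rw [pow_succ'] at hr
    rw [Ideal.IsTwoSided.pow_succ]
    induction hr using Submodule.mul_induction_on' with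
    | add x _ y _ h h' => exact add_mem h h'
    | mem_mul_mem a ha b hb => exact Ideal.mul_mem_mul ha (ih hb)

theorem mem_pow_of_mem_smul_top (n : ℕ) {x : A}
    (hx : x ∈ evenIdeal I ^ n • (⊤ : Submodule (evenPart 𝒜) A)) : x ∈ I.toIdeal ^ n := by
  induction hx using Submodule.smul_induction_on' with
  | add x _ y _ h h' => exact add_mem h h'
  | smul r hr a _ =>
    change (r : A) * a ∈ _
    rw [even_comm' 𝒜 r.2]
    exact Ideal.mul_mem_left _ _ (coe_mem_pow I n hr)

end Topology

universe u

/-! ### The completion of `A` over the completion of its even part. -/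

section Comparison

variable {A : Type u} [Ring A] {𝒜 : ZMod 2 → AddSubgroup A} [SuperRing 𝒜]
variable (I : HomogeneousIdeal 𝒜)

/-- The comparison map from the completion of `A` as a module over its even part. -/
def ofModuleCompletion : AdicCompletion (evenIdeal I) A →+ completion I where
  toFun x := ⟨fun n => QuotientAddGroup.map _ (I.toIdeal ^ n).toAddSubgroup (AddMonoidHom.id A)
      (fun _ h => mem_pow_of_mem_smul_top I n h) (x.val n), by
    obtain ⟨x, rfl⟩ := AdicCompletion.mk_surjective _ _ x
    intro m n h
    change Ideal.Quotient.mk (I.toIdeal ^ m) (x.val n) = Ideal.Quotient.mk (I.toIdeal ^ m) (x.val m)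
    rw [Ideal.Quotient.eq]
    exact mem_pow_of_mem_smul_top I m (SModEq.sub_mem.mp (x.property h).symm)⟩
  map_zero' := rfl
  map_add' x y := Subtype.ext (funext fun n => map_add _ _ _)

/-- The comparison map from the completion of the even part. -/
noncomputable def ofEvenCompletion :
    AdicCompletion (evenIdeal I) (evenPart 𝒜) →+* completion I where
  toFun x := ofModuleCompletion I (map (evenIdeal I) (Algebra.linearMap (evenPart 𝒜) A) x)
  map_zero' := by rw [_root_.map_zero, _root_.map_zero]
  map_add' x y := by rw [map_add, map_add]
  map_one' := rfl
  map_mul' x y := by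
    obtain ⟨x, rfl⟩ := AdicCompletion.mk_surjective _ _ x
    obtain ⟨y, rfl⟩ := AdicCompletion.mk_surjective _ _ y
    rfl

/-- The canonical map to the completion. -/
def toCompletion : A →+* completion I where
  toFun a := ⟨fun _ => Ideal.Quotient.mk _ a, fun _ _ _ => rfl⟩
  map_zero' := rfl
  map_one' := rfl
  map_add' _ _ := rfl
  map_mul' _ _ := rfl

theorem toCompletion_mem {i : ZMod 2} {a : A} (ha : a ∈ 𝒜 i) :
    toCompletion I a ∈ completionGrading I i := fun _ => ⟨a, ha, rfl⟩

theorem ofModuleCompletion_of (a : A) :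
    ofModuleCompletion I (of (evenIdeal I) A a) = toCompletion I a := rfl

theorem ofEvenCompletion_algebraMap (r : evenPart 𝒜) :
    ofEvenCompletion I (algebraMap _ _ r) = toCompletion I (r : A) := rfl

theorem ofModuleCompletion_smul (t : AdicCompletion (evenIdeal I) (evenPart 𝒜))
    (x : AdicCompletion (evenIdeal I) A) :
    ofModuleCompletion I (t • x) = ofEvenCompletion I t * ofModuleCompletion I x := by
  obtain ⟨t, rfl⟩ := AdicCompletion.mk_surjective _ _ t
  obtain ⟨x, rfl⟩ := AdicCompletion.mk_surjective _ _ x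
  rfl

theorem ofEvenCompletion_mem (t : AdicCompletion (evenIdeal I) (evenPart 𝒜)) :
    ofEvenCompletion I t ∈ completionGrading I 0 := by
  obtain ⟨t, rfl⟩ := AdicCompletion.mk_surjective _ _ t
  exact fun n => ⟨t.val n, (t.val n).2, rfl⟩

theorem ofEvenCompletion_comm (t : AdicCompletion (evenIdeal I) (evenPart 𝒜))
    (x : completion I) : ofEvenCompletion I t * x = x * ofEvenCompletion I t :=
  even_comm' (completionGrading I) (ofEvenCompletion_mem I t) x

variable {I} (hN : IsNoetherian 𝒜)
include hN

theorem ofModuleCompletion_injective : Function.Injective (ofModuleCompletion I) := by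
  obtain ⟨k, hk⟩ := exists_pow_le_smul_top I hN
  rw [injective_iff_map_eq_zero]
  intro x hx
  obtain ⟨x, rfl⟩ := AdicCompletion.mk_surjective _ _ x
  refine AdicCompletion.mk_zero_of _ _ _ ⟨0, fun n _ => ⟨2 * (n + k), by omega, n, le_rfl, ?_⟩⟩
  apply hk
  rw [← Ideal.Quotient.eq_zero_iff_mem]
  exact congrFun (congrArg Subtype.val hx) (2 * (n + k))

theorem ofModuleCompletion_surjective : Function.Surjective (ofModuleCompletion I) := by
  obtain ⟨k, hk⟩ := exists_pow_le_smul_top I hN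
  intro y
  choose a ha using fun n => Ideal.Quotient.mk_surjective (y.1 n)
  have hy : ∀ m n, m ≤ n → a m - a n ∈ I.toIdeal ^ m := fun m n h => by
    rw [← Ideal.Quotient.eq, ha, ← y.2 m n h, ← ha n]; rfl
  -- Passing to the indices `2 * (n + k)` makes the representatives Cauchy for the even part of `I`.
  let f := AdicCauchySequence.mk (evenIdeal I) A (fun n => a (2 * (n + k)))
    (fun n => SModEq.sub_mem.mpr (hk n _ (hy _ _ (by omega))))
  refine ⟨AdicCompletion.mk _ _ f, Subtype.ext (funext fun n => ?_)⟩
  rw [← ha]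
  refine ((Ideal.Quotient.eq (I := I.toIdeal ^ n)).mpr (hy n (2 * (n + k)) (by omega))).symm

/-- The completion of the finite module `A` is a quotient of its base change, and splitting each
pure tensor by parity gives the two summands. -/
theorem exists_add_mem_closure (x : completion I) :
    ∃ v : ZMod 2 → completion I, (∀ i, v i ∈ AddSubgroup.closure
      {z | ∃ t, ∃ b ∈ 𝒜 i, z = ofEvenCompletion I t * toCompletion I b}) ∧ v 0 + v 1 = x := by
  have := hN.evenPart
  have := hN.finite
  obtain ⟨x, rfl⟩ := ofModuleCompletion_surjective hN x
  obtain ⟨x, rfl⟩ := ofTensorProduct_surjective_of_finite (evenIdeal I) A x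
  induction x with
  | zero => exact ⟨0, fun i => zero_mem _, by simp⟩
  | add x y hx hy =>
    obtain ⟨v, hv, hvx⟩ := hx
    obtain ⟨w, hw, hwy⟩ := hy
    exact ⟨v + w, fun i => add_mem (hv i) (hw i), by
      rw [map_add, map_add, ← hvx, ← hwy]; exact add_add_add_comm _ _ _ _⟩
  | tmul t a =>
    refine ⟨fun i => ofEvenCompletion I t * toCompletion I (GradedRing.proj 𝒜 i a),
      fun i => AddSubgroup.subset_closure ⟨t, _, proj_mem 𝒜 i a, rfl⟩, ?_⟩
    rw [ofTensorProduct_tmul, ofModuleCompletion_smul, ofModuleCompletion_of, ← mul_add, ← map_add,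
      proj_add_proj]

theorem mem_closure_of_mem {i : ZMod 2} {x : completion I} (hx : x ∈ completionGrading I i) :
    x ∈ AddSubgroup.closure
      {z | ∃ t, ∃ b ∈ 𝒜 i, z = ofEvenCompletion I t * toCompletion I b} := by
  have hle : ∀ i : ZMod 2, AddSubgroup.closure
      {z | ∃ t, ∃ b ∈ 𝒜 i, z = ofEvenCompletion I t * toCompletion I b}
        ≤ completionGrading I i := by
    intro i
    rw [AddSubgroup.closure_le]
    rintro _ ⟨t, b, hb, rfl⟩
    have := SetLike.mul_mem_graded (A := completionGrading I) (ofEvenCompletion_mem I t)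
      (toCompletion_mem I hb)
    rwa [zero_add] at this
  obtain ⟨v, hv, rfl⟩ := exists_add_mem_closure hN x
  have hi : i = 0 ∨ i = 1 := (by decide : ∀ k : ZMod 2, k = 0 ∨ k = 1) i
  rcases hi with rfl | rfl
  · have h : v 1 = 0 := eq_zero_of_mem_mem (completionGrading I)
      (by have := sub_mem hx (hle 0 (hv 0)); rwa [add_sub_cancel_left] at this) (hle 1 (hv 1))
    rw [h, add_zero]; exact hv 0
  · have h : v 0 = 0 := eq_zero_of_mem_mem (completionGrading I) (hle 0 (hv 0))
      (by have := sub_mem hx (hle 1 (hv 1)); rwa [add_sub_cancel_right] at this)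
    rw [h, zero_add]; exact hv 1

theorem mem_map_of_ofEvenCompletion_mul_eq_zero (a : Ideal (evenPart 𝒜)) (y : A)
    (ha : evenAnn 𝒜 y ≤ a) (t : AdicCompletion (evenIdeal I) (evenPart 𝒜))
    (ht : ofEvenCompletion I t * toCompletion I y = 0) : t ∈ a.map (algebraMap _ _) := by
  have := hN.evenPart
  have := hN.finite
  refine mem_map_of_smul_of_eq_zero (evenIdeal I) a y (fun r hr => ha hr) t ?_
  apply ofModuleCompletion_injective hN
  rw [ofModuleCompletion_smul, ofModuleCompletion_of, ht, _root_.map_zero]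

theorem ofEvenCompletion_injective : Function.Injective (ofEvenCompletion I) := by
  rw [injective_iff_map_eq_zero]
  intro t ht
  -- The element `1` has zero annihilator, whose extension is zero.
  have := mem_map_of_ofEvenCompletion_mul_eq_zero hN ⊥ 1
    (fun r hr => Subtype.ext ((mul_one (r : A)).symm.trans hr)) t (by rw [ht, zero_mul])
  rwa [Ideal.map_bot] at this

theorem exists_ofEvenCompletion_eq {x : completion I} (hx : x ∈ completionGrading I 0) :
    ∃ t, ofEvenCompletion I t = x := by
  refine AddSubgroup.closure_induction (p := fun x _ => ∃ t, ofEvenCompletion I t = x) ?_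
    ⟨0, _root_.map_zero _⟩ ?_ ?_ (mem_closure_of_mem hN hx)
  · rintro _ ⟨t, b, hb, rfl⟩
    exact ⟨t * algebraMap _ _ (⟨b, hb⟩ : evenPart 𝒜), map_mul _ _ _⟩
  · rintro _ _ - - ⟨s, rfl⟩ ⟨t, rfl⟩
    exact ⟨s + t, map_add _ _ _⟩
  · rintro _ - ⟨s, rfl⟩
    exact ⟨-s, map_neg _ _⟩

/-- The even part of the completion is the completion of the even part. -/
noncomputable def evenCompletionEquiv :
    AdicCompletion (evenIdeal I) (evenPart 𝒜) ≃+* evenPart (completionGrading I) :=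
  RingEquiv.ofBijective
    ((ofEvenCompletion I).codRestrict (evenPart (completionGrading I)) (ofEvenCompletion_mem I))
    ⟨fun s t h => ofEvenCompletion_injective hN (congrArg Subtype.val h), fun x => by
      obtain ⟨t, ht⟩ := exists_ofEvenCompletion_eq hN x.2
      exact ⟨t, Subtype.ext ht⟩⟩

/-- If every `b` failed, each term of `x`, written as a finite sum of `s * b`, would be killed
between `v` and `w` by some element outside `P`. The product of these elements is again outside `P`
and kills `v * x * w`, a contradiction. -/
theorem exists_odd_mul (P : Ideal (AdicCompletion (evenIdeal I) (evenPart 𝒜))) [P.IsPrime]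
    {x : completion I} (hx : x ∈ completionGrading I 1) (v w : completion I)
    (h : ∀ t, ofEvenCompletion I t * (v * x * w) = 0 → t ∈ P) :
    ∃ b ∈ 𝒜 1, ∀ t, ofEvenCompletion I t * (v * toCompletion I b * w) = 0 → t ∈ P := by
  by_contra! hc
  have key : ∃ t ∉ P, ofEvenCompletion I t * (v * x * w) = 0 := by
    refine AddSubgroup.closure_induction
      (p := fun x _ => ∃ t ∉ P, ofEvenCompletion I t * (v * x * w) = 0) ?_ ?_ ?_ ?_
      (mem_closure_of_mem hN hx)
    · rintro _ ⟨s, b, hb, rfl⟩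
      obtain ⟨t, ht, htP⟩ := hc b hb
      refine ⟨t, htP, ?_⟩
      rw [← mul_assoc v, ← ofEvenCompletion_comm I s v, mul_assoc _ v, mul_assoc _ (v * _),
        ← mul_assoc, ofEvenCompletion_comm I t, mul_assoc, ht, mul_zero]
    · exact ⟨1, (Ideal.ne_top_iff_one P).mp Ideal.IsPrime.ne_top', by simp⟩
    · rintro x y - - ⟨s, hs, hsx⟩ ⟨t, ht, hty⟩
      refine ⟨s * t, fun hst => (Ideal.IsPrime.mem_or_mem ‹_› hst).elim hs ht, ?_⟩
      rw [mul_add, add_mul, mul_add, map_mul, mul_assoc _ _ (v * y * w), hty, mul_zero,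
        ofEvenCompletion_comm, mul_assoc, hsx, mul_zero, add_zero]
    · rintro x - ⟨s, hs, hsx⟩
      exact ⟨s, hs, by rw [mul_neg, neg_mul, mul_neg, hsx, neg_zero]⟩
  obtain ⟨t, ht, h0⟩ := key
  exact ht (h t h0)

/-- Factors are replaced one at a time; `v` carries the prefix already replaced. -/
theorem exists_odd_list (P : Ideal (AdicCompletion (evenIdeal I) (evenPart 𝒜))) [P.IsPrime]
    (l : List (completion I)) (hl : ∀ x ∈ l, x ∈ completionGrading I 1) (v : completion I)
    (h : ∀ t, ofEvenCompletion I t * (v * l.prod) = 0 → t ∈ P) :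
    ∃ l' : List A, l'.length = l.length ∧ (∀ b ∈ l', b ∈ 𝒜 1) ∧
      ∀ t, ofEvenCompletion I t * (v * toCompletion I l'.prod) = 0 → t ∈ P := by
  induction l generalizing v with
  | nil => exact ⟨[], rfl, by simp, by simpa using h⟩
  | cons x l ih =>
    rw [List.forall_mem_cons] at hl
    obtain ⟨b, hb, hbP⟩ := exists_odd_mul hN P hl.1 v l.prod
      (fun t ht => h t (by rwa [List.prod_cons, ← mul_assoc v]))
    obtain ⟨l', hlen, hl', hP⟩ := ih hl.2 _ hbP
    refine ⟨b :: l', by simp [hlen], List.forall_mem_cons.mpr ⟨hb, hl'⟩, fun t ht => hP t ?_⟩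
    rwa [List.prod_cons, map_mul, ← mul_assoc v] at ht

/-- A chain of primes of the even part, below a prime containing `I`, lifts to the completion. -/
theorem exists_completion_chain (p : Ideal (evenPart 𝒜)) [p.IsPrime] (hp : evenIdeal I ≤ p)
    (y : A) (c : LTSeries (PrimeSpectrum (evenPart 𝒜))) (hc : c.last.asIdeal ≤ p)
    (hy : evenAnn 𝒜 y ≤ c.head.asIdeal) :
    ∃ C : LTSeries (PrimeSpectrum (evenPart (completionGrading I))), C.length = c.length ∧
      evenAnn (completionGrading I) (toCompletion I y) ≤ C.head.asIdeal := by
  have := hN.evenPart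
  obtain ⟨C, hC, hCc⟩ := exists_ltSeries_adicCompletion (evenIdeal I) p hp c hc
  let e := evenCompletionEquiv (I := I) hN
  refine ⟨C.map (PrimeSpectrum.comapEquiv e) (PrimeSpectrum.comapEquiv e).strictMono, hC, ?_⟩
  intro s hs
  obtain ⟨t, rfl⟩ := e.surjective s
  have ht := mem_map_of_ofEvenCompletion_mul_eq_zero hN c.head.asIdeal y hy t hs
  rw [← hCc] at ht
  have ht' := Ideal.map_comap_le ht
  rw [LTSeries.head_map]
  change e.symm (e t) ∈ C.head.asIdeal
  rwa [e.symm_apply_apply]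

/-- A chain of primes of the even part of the completion descends to a chain below a prime
containing `I`. -/
theorem exists_chain_of_completion (l : List (completion I))
    (hl : ∀ x ∈ l, x ∈ completionGrading I 1)
    (C : LTSeries (PrimeSpectrum (evenPart (completionGrading I))))
    (hC : evenAnn (completionGrading I) l.prod ≤ C.head.asIdeal) :
    ∃ p : Ideal (evenPart 𝒜), p.IsPrime ∧ evenIdeal I ≤ p ∧
      ∃ l' : List A, l'.length = l.length ∧ (∀ b ∈ l', b ∈ 𝒜 1) ∧
      ∃ c : LTSeries (PrimeSpectrum (evenPart 𝒜)), c.length = C.length ∧ c.last.asIdeal ≤ p ∧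
        evenAnn 𝒜 l'.prod ≤ c.head.asIdeal := by
  have := hN.evenPart
  let e := evenCompletionEquiv (I := I) hN
  let C' := C.map (PrimeSpectrum.comapEquiv e).symm (PrimeSpectrum.comapEquiv e).symm.strictMono
  have hC' : ∀ t, ofEvenCompletion I t * l.prod = 0 → t ∈ C'.head.asIdeal := by
    intro t ht
    rw [LTSeries.head_map]
    exact hC (show e t ∈ _ from ht)
  obtain ⟨l', hlen, hl', hP⟩ := exists_odd_list hN C'.head.asIdeal l hl 1
    (fun t ht => hC' t (by rwa [one_mul] at ht))
  obtain ⟨p, hp, hIp, c, hc, hcp, hhead⟩ := exists_ltSeries_of_adicCompletion (evenIdeal I) C'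
  refine ⟨p, hp, hIp, l', hlen, hl', c, hc, hcp, fun r hr => hhead (hP _ ?_)⟩
  rw [ofEvenCompletion_algebraMap, one_mul, ← map_mul, show (r : A) * l'.prod = 0 from hr,
    _root_.map_zero]

end Comparison

/-! ### Prime super-ideals and primes of the even part. -/

section PrimeSuperIdeals

variable {A : Type*} [Ring A] {𝒜 : ZMod 2 → AddSubgroup A} [SuperRing 𝒜]

theorem IsPrime.evenIdeal_isPrime {p : HomogeneousIdeal 𝒜} (hp : IsPrime p) :
    (evenIdeal p).IsPrime where
  ne_top' h := (primeCompl p hp).one_mem ((Ideal.eq_top_iff_one (evenIdeal p)).mp h)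
  mem_or_mem' {r s} h := by
    by_contra! hc
    exact (primeCompl p hp).mul_mem hc.1 hc.2 h

theorem evenIdeal_mono {I p : HomogeneousIdeal 𝒜} (h : I ≤ p) : evenIdeal I ≤ evenIdeal p :=
  Ideal.comap_mono h

theorem proj_zero_mul (x y : A) : GradedRing.proj 𝒜 0 (x * y) =
    GradedRing.proj 𝒜 0 x * GradedRing.proj 𝒜 0 y +
      GradedRing.proj 𝒜 1 x * GradedRing.proj 𝒜 1 y := by
  have h := fun i j => SetLike.mul_mem_graded (A := 𝒜) (proj_mem 𝒜 i x) (proj_mem 𝒜 j y)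
  conv_lhs => rw [← proj_add_proj 𝒜 x, ← proj_add_proj 𝒜 y]
  rw [add_mul, mul_add, mul_add, map_add, map_add, map_add, proj_of_mem 𝒜 (i := 0) (h 0 0),
    proj_of_mem_ne 𝒜 (by decide) (h 0 1), proj_of_mem_ne 𝒜 (by decide) (h 1 0),
    proj_of_mem 𝒜 (i := 0) (h 1 1), add_zero, zero_add]

variable (𝒜) in
/-- The even component of an element. -/
noncomputable def evenComponent (x : A) : evenPart 𝒜 := ⟨_, proj_mem 𝒜 0 x⟩

/-- The even part of `x * y` differs from `x₀ * y₀` by `x₁ * y₁`, which is nilpotent and so lies in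
every prime. -/
theorem evenComponent_mul_mem_iff (q : Ideal (evenPart 𝒜)) [q.IsPrime] (x y : A) :
    evenComponent 𝒜 (x * y) ∈ q ↔ evenComponent 𝒜 x * evenComponent 𝒜 y ∈ q := by
  have h : evenComponent 𝒜 (x * y) = evenComponent 𝒜 x * evenComponent 𝒜 y +
      ⟨_, mul_odd_mem_evenPart (proj_mem 𝒜 1 x) (proj_mem 𝒜 1 y)⟩ :=
    Subtype.ext (proj_zero_mul x y)
  rw [h]
  exact q.add_mem_iff_left (nilradical_le_prime q
    (mul_odd_mem_nilradical (proj_mem 𝒜 1 x) (proj_mem 𝒜 1 y)))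

theorem evenComponent_coe (r : evenPart 𝒜) : evenComponent 𝒜 (r : A) = r :=
  Subtype.ext (proj_of_mem 𝒜 r.2)

/-- The prime super-ideal with a given prime even part. -/
noncomputable def primeOfEven (q : Ideal (evenPart 𝒜)) [q.IsPrime] : HomogeneousIdeal 𝒜 where
  carrier := {x | evenComponent 𝒜 x ∈ q}
  add_mem' {x y} hx hy := by
    have h : evenComponent 𝒜 (x + y) = evenComponent 𝒜 x + evenComponent 𝒜 y :=
      Subtype.ext (map_add _ _ _)
    change evenComponent 𝒜 (x + y) ∈ q
    rw [h]; exact add_mem hx hy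
  zero_mem' := by
    have h : evenComponent 𝒜 (0 : A) = 0 := Subtype.ext (map_zero _)
    change evenComponent 𝒜 (0 : A) ∈ q
    rw [h]; exact zero_mem q
  smul_mem' a x hx := (evenComponent_mul_mem_iff q a x).mpr (q.mul_mem_left _ hx)
  is_homogeneous' i x hx := by
    have hi : i = 0 ∨ i = 1 := (by decide : ∀ k : ZMod 2, k = 0 ∨ k = 1) i
    rcases hi with rfl | rfl
    · change evenComponent 𝒜 (evenComponent 𝒜 x : A) ∈ q
      rw [evenComponent_coe]; exact hx
    · have h : evenComponent 𝒜 (GradedRing.proj 𝒜 1 x) = 0 :=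
        Subtype.ext (proj_of_mem_ne 𝒜 (by decide) (proj_mem 𝒜 1 x))
      change evenComponent 𝒜 (GradedRing.proj 𝒜 1 x) ∈ q
      rw [h]; exact zero_mem q

theorem mem_primeOfEven (q : Ideal (evenPart 𝒜)) [q.IsPrime] (x : A) :
    x ∈ (primeOfEven q).toIdeal ↔ evenComponent 𝒜 x ∈ q := Iff.rfl

theorem evenIdeal_primeOfEven (q : Ideal (evenPart 𝒜)) [q.IsPrime] :
    evenIdeal (primeOfEven q) = q := by
  ext r
  change evenComponent 𝒜 (r : A) ∈ q ↔ _
  rw [evenComponent_coe]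

theorem primeOfEven_isPrime (q : Ideal (evenPart 𝒜)) [hq : q.IsPrime] :
    IsPrime (primeOfEven q) := by
  have h1 : Nontrivial (A ⧸ (primeOfEven q).toIdeal) := by
    refine ⟨⟨1, 0, fun h => ?_⟩⟩
    have h' := Ideal.Quotient.eq_zero_iff_mem.mp ((map_one (Ideal.Quotient.mk _)).trans h)
    rw [mem_primeOfEven, show evenComponent 𝒜 (1 : A) = 1 from evenComponent_coe 1] at h'
    exact hq.ne_top ((Ideal.eq_top_iff_one q).mpr h')
  have h2 : NoZeroDivisors (A ⧸ (primeOfEven q).toIdeal) := by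
    refine ⟨fun {x y} h => ?_⟩
    obtain ⟨x, rfl⟩ := Ideal.Quotient.mk_surjective x
    obtain ⟨y, rfl⟩ := Ideal.Quotient.mk_surjective y
    rw [← map_mul, Ideal.Quotient.eq_zero_iff_mem, mem_primeOfEven,
      evenComponent_mul_mem_iff] at h
    rw [Ideal.Quotient.eq_zero_iff_mem, Ideal.Quotient.eq_zero_iff_mem]
    exact hq.mem_or_mem h
  exact NoZeroDivisors.to_isDomain _

theorem le_primeOfEven {I : HomogeneousIdeal 𝒜} (q : Ideal (evenPart 𝒜)) [q.IsPrime]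
    (h : evenIdeal I ≤ q) : I ≤ primeOfEven q :=
  fun x hx => h (show evenComponent 𝒜 x ∈ evenIdeal I from I.isHomogeneous 0 hx)

end PrimeSuperIdeals

/-! ### The even part of a localization, and annihilators there. -/

section Localization

variable {A : Type*} [Ring A] (𝒜 : ZMod 2 → AddSubgroup A) [SuperRing 𝒜]
variable (S : Submonoid (evenPart 𝒜))

/-- The canonical map from the even part to the even part of the localization. -/
noncomputable def toLocalization : evenPart 𝒜 →+* evenPart (localizationGrading 𝒜 S) where
  toFun r := ⟨LocalizedModule.mk (r : A) 1, r, r.2, 1, rfl⟩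
  map_zero' := Subtype.ext (LocalizedModule.zero_mk 1)
  map_one' := Subtype.ext OreLocalization.one_def.symm
  map_add' r s := Subtype.ext (by
    change _ = LocalizedModule.mk (r : A) 1 + LocalizedModule.mk (s : A) 1
    rw [LocalizedModule.mk_add_mk]; simp)
  map_mul' r s := Subtype.ext (by
    change _ = LocalizedModule.mk (r : A) 1 * LocalizedModule.mk (s : A) 1
    rw [LocalizedModule.mk_mul_mk]; simp)

noncomputable instance : Algebra (evenPart 𝒜) (evenPart (localizationGrading 𝒜 S)) :=
  (toLocalization 𝒜 S).toAlgebra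

theorem mk_self_eq_one (s : S) : LocalizedModule.mk ((s : evenPart 𝒜) : A) s = 1 := by
  rw [show (1 : LocalizedModule S A) = LocalizedModule.mk 1 1 from OreLocalization.one_def,
    LocalizedModule.mk_eq]
  refine ⟨1, ?_⟩
  rw [one_smul, one_smul, one_smul]
  exact (mul_one _).symm

instance : IsLocalization S (evenPart (localizationGrading 𝒜 S)) where
  map_units s := by
    refine IsUnit.of_mul_eq_one ⟨LocalizedModule.mk 1 s, 1, SetLike.one_mem_graded 𝒜, s, rfl⟩ ?_
    refine Subtype.ext ?_
    change LocalizedModule.mk ((s : evenPart 𝒜) : A) 1 * LocalizedModule.mk 1 s = 1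
    rw [LocalizedModule.mk_mul_mk, one_mul, mul_one, mk_self_eq_one]
  surj := by
    rintro ⟨_, a, ha, s, rfl⟩
    refine ⟨(⟨a, ha⟩, s), Subtype.ext ?_⟩
    change LocalizedModule.mk a s * LocalizedModule.mk ((s : evenPart 𝒜) : A) 1 =
      LocalizedModule.mk a 1
    rw [LocalizedModule.mk_mul_mk, mul_one, LocalizedModule.mk_eq]
    refine ⟨1, ?_⟩
    rw [one_smul, one_smul, one_smul]
    exact (even_comm' 𝒜 (s : evenPart 𝒜).2 a).symm
  exists_of_eq {x y} h := by
    obtain ⟨u, hu⟩ := LocalizedModule.mk_eq.mp (congrArg Subtype.val h)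
    rw [one_smul, one_smul] at hu
    exact ⟨u, Subtype.ext hu⟩

variable {𝒜 S}

theorem algebraMap_mem_evenAnn (y : A) (s : S) {r : evenPart 𝒜} (hr : r ∈ evenAnn 𝒜 y) :
    algebraMap _ (evenPart (localizationGrading 𝒜 S)) r ∈
      evenAnn (localizationGrading 𝒜 S) (LocalizedModule.mk y s) := by
  change LocalizedModule.mk (r : A) 1 * LocalizedModule.mk y s = 0
  rw [LocalizedModule.mk_mul_mk, show (r : A) * y = 0 from hr, LocalizedModule.zero_mk]

/-- Clearing denominators: a prime of `A₀` that avoids `S` and contains `Ann(y)` must contain the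
numerator `r`, since it does not contain `u`. -/
theorem exists_mul_mem_evenAnn (y : A) (s : S) {z : evenPart (localizationGrading 𝒜 S)}
    (hz : z ∈ evenAnn (localizationGrading 𝒜 S) (LocalizedModule.mk y s)) :
    ∃ (u : S) (r : evenPart 𝒜), (u : evenPart 𝒜) * r ∈ evenAnn 𝒜 y ∧
      Associated (algebraMap _ (evenPart (localizationGrading 𝒜 S)) r) z := by
  obtain ⟨⟨r, t⟩, hrt⟩ := IsLocalization.surj S z
  have h0 : algebraMap _ (evenPart (localizationGrading 𝒜 S)) r ∈
      evenAnn (localizationGrading 𝒜 S) (LocalizedModule.mk y s) := by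
    rw [← hrt]; exact Ideal.mul_mem_right _ _ hz
  have h1 : LocalizedModule.mk ((r : A) * y) (1 * s) = LocalizedModule.mk (0 : A) 1 := by
    rw [LocalizedModule.zero_mk, ← LocalizedModule.mk_mul_mk]; exact h0
  obtain ⟨u, hu⟩ := LocalizedModule.mk_eq.mp h1
  rw [one_smul, smul_zero, smul_zero] at hu
  refine ⟨u, r, ?_, ?_⟩
  · change ((u : evenPart 𝒜) : A) * (r : A) * y = 0
    rw [mul_assoc]; exact hu
  · obtain ⟨v, hv⟩ := IsLocalization.map_units (evenPart (localizationGrading 𝒜 S)) t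
    exact Associated.symm ⟨v, by rw [hv]; exact hrt⟩

theorem exists_list_of_localization (l : List (LocalizedModule S A))
    (hl : ∀ x ∈ l, x ∈ localizationGrading 𝒜 S 1) :
    ∃ (l' : List A) (s : S), l'.length = l.length ∧ (∀ b ∈ l', b ∈ 𝒜 1) ∧
      l.prod = LocalizedModule.mk l'.prod s := by
  induction l with
  | nil => exact ⟨[], 1, rfl, by simp, OreLocalization.one_def⟩
  | cons x l ih =>
    rw [List.forall_mem_cons] at hl
    obtain ⟨l', s, hlen, hl', hprod⟩ := ih hl.2
    obtain ⟨b, hb, t, rfl⟩ := hl.1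
    refine ⟨b :: l', t * s, by simp [hlen], List.forall_mem_cons.mpr ⟨hb, hl'⟩, ?_⟩
    rw [List.prod_cons, List.prod_cons, hprod, LocalizedModule.mk_mul_mk]

theorem prod_map_mk (l : List A) :
    (l.map fun b => (LocalizedModule.mk b 1 : LocalizedModule S A)).prod =
      LocalizedModule.mk l.prod 1 := by
  induction l with
  | nil => exact OreLocalization.one_def
  | cons b l ih =>
    rw [List.map_cons, List.prod_cons, List.prod_cons, ih, LocalizedModule.mk_mul_mk, one_mul]

end Localization

/-! ### Chains of primes and the super-dimension -/

section Chains

variable {A : Type*} [Ring A] (𝒜 : ZMod 2 → AddSubgroup A) [SuperRing 𝒜]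

/-- There are `s` odd elements, the annihilator of whose product lies in the bottom of a chain
of primes of length `n`. -/
def HasOddChain (n s : ℕ) : Prop :=
  ∃ l : List A, l.length = s ∧ (∀ b ∈ l, b ∈ 𝒜 1) ∧
    ∃ c : LTSeries (PrimeSpectrum (evenPart 𝒜)), c.length = n ∧
      evenAnn 𝒜 l.prod ≤ c.head.asIdeal

variable {𝒜}

theorem evenAnn_one_le (J : Ideal (evenPart 𝒜)) : evenAnn 𝒜 1 ≤ J := by
  intro r hr
  rw [show r = 0 from Subtype.ext ((mul_one (r : A)).symm.trans hr)]
  exact zero_mem J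

theorem hasOddChain_zero_iff (n : ℕ) : HasOddChain 𝒜 n 0 ↔ (n : WithBot ℕ∞) ≤ Ksdim₀ 𝒜 := by
  rw [Ksdim₀, ringKrullDim, Order.le_krullDim_iff]
  constructor
  · rintro ⟨-, -, -, c, hc, -⟩
    exact ⟨c, hc⟩
  · rintro ⟨c, hc⟩
    exact ⟨[], rfl, by simp, c, hc, by rw [List.prod_nil]; exact evenAnn_one_le _⟩

theorem HasOddChain.zero {n s : ℕ} (h : HasOddChain 𝒜 n s) : HasOddChain 𝒜 n 0 := by
  obtain ⟨-, -, -, c, hc, -⟩ := h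
  exact ⟨[], rfl, by simp, c, hc, by rw [List.prod_nil]; exact evenAnn_one_le _⟩

/-- A quotient never has larger dimension, so equality with the finite value `n` only requires a
chain of length `n` above the annihilator. -/
theorem exists_isSystemOfOddParameters_iff {n : ℕ} (hn : Ksdim₀ 𝒜 = n) (s : ℕ) :
    (∃ y : Fin s → 𝒜 1, IsSystemOfOddParameters 𝒜 y) ↔ HasOddChain 𝒜 n s := by
  have hdim : ringKrullDim (evenPart 𝒜) = n := hn
  have key : ∀ b : A, ringKrullDim (evenPart 𝒜) = ringKrullDim (evenPart 𝒜 ⧸ evenAnn 𝒜 b) ↔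
      ∃ c : LTSeries (PrimeSpectrum (evenPart 𝒜)), c.length = n ∧
        evenAnn 𝒜 b ≤ c.head.asIdeal := by
    intro b
    rw [← le_ringKrullDim_quotient_iff, ← hdim]
    exact ⟨le_of_eq, fun h => le_antisymm h (ringKrullDim_quotient_le _)⟩
  constructor
  · rintro ⟨y, hy⟩
    refine ⟨List.ofFn fun i => (y i : A), List.length_ofFn, ?_, (key _).mp hy⟩
    intro b hb
    obtain ⟨i, rfl⟩ := (List.mem_ofFn' _ _).mp hb
    exact (y i).2
  · rintro ⟨l, rfl, hl, h⟩
    refine ⟨fun i => ⟨l.get i, hl _ (l.get_mem i)⟩, ?_⟩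
    rw [IsSystemOfOddParameters, key]
    simpa only [List.ofFn_get] using h

theorem nontrivial_of_Ksdim₀_eq {n : ℕ} (hn : Ksdim₀ 𝒜 = n) : Nontrivial A := by
  by_contra h
  rw [not_nontrivial_iff_subsingleton] at h
  have hs : Subsingleton (evenPart 𝒜) := ⟨fun _ _ => Subtype.ext (Subsingleton.elim _ _)⟩
  rw [Ksdim₀, ringKrullDim_eq_bot_of_subsingleton] at hn
  exact WithBot.bot_ne_coe hn

theorem HasOddChain.le_Ksdim₁ {n s : ℕ} (hn : Ksdim₀ 𝒜 = n) (h : HasOddChain 𝒜 n s) :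
    (s : ℕ∞) ≤ Ksdim₁ 𝒜 :=
  le_iSup₂_of_le s
    ⟨nontrivial_of_Ksdim₀_eq hn, (exists_isSystemOfOddParameters_iff hn s).mpr h⟩ le_rfl

theorem Ksdim₁_le {n : ℕ} (hn : Ksdim₀ 𝒜 = n) (t : ℕ∞) (h : ∀ s, HasOddChain 𝒜 n s → s ≤ t) :
    Ksdim₁ 𝒜 ≤ t :=
  iSup₂_le fun s hs => h s ((exists_isSystemOfOddParameters_iff hn s).mp hs.2)

theorem Ksdim_eq_bot (h : Ksdim₀ 𝒜 = ⊥) : Ksdim 𝒜 = ⊥ := by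
  have hA : ¬ Nontrivial A := by
    intro hA
    have : Nontrivial (evenPart 𝒜) := inferInstance
    have := ringKrullDim_nonneg_of_nontrivial (R := evenPart 𝒜)
    rw [show ringKrullDim (evenPart 𝒜) = ⊥ from h] at this
    simp at this
  -- In the zero ring every sequence satisfies the dimension equality; the `Nontrivial` clause in
  -- `Ksdim₁` is what makes the supremum empty.
  have h1 : Ksdim₁ 𝒜 = 0 := by
    rw [Ksdim₁, ← bot_eq_zero, eq_bot_iff]
    exact iSup₂_le fun s hs => absurd hs.1 hA
  rw [Ksdim, h, h1]; rfl

theorem Ksdim₀_eq_bot_or_nat (h : Ksdim₀ 𝒜 < ⊤) : Ksdim₀ 𝒜 = ⊥ ∨ ∃ n : ℕ, Ksdim₀ 𝒜 = n := by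
  induction hd : Ksdim₀ 𝒜 with
  | bot => exact .inl rfl
  | coe m =>
    rw [hd] at h
    induction m with
    | top => exact absurd h (lt_irrefl _)
    | coe m => exact .inr ⟨m, rfl⟩

end Chains

/-! ### Comparison of super-dimensions and the supremum. -/

section Main

variable {A : Type*} [Ring A] {𝒜 : ZMod 2 → AddSubgroup A} [SuperRing 𝒜]

/-- Odd dimensions matter lexicographically only when the even dimensions agree, and then both are
read off from chains of the same length `n`. -/
theorem Ksdim_mono_of_hasOddChain {B : Type*} [Ring B] {ℬ : ZMod 2 → AddSubgroup B} [SuperRing ℬ]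
    (hA : Ksdim₀ 𝒜 < ⊤) (h : ∀ n s, HasOddChain 𝒜 n s → HasOddChain ℬ n s) :
    Ksdim 𝒜 ≤ Ksdim ℬ := by
  obtain h0 | ⟨n, hn⟩ := Ksdim₀_eq_bot_or_nat hA
  · rw [Ksdim_eq_bot h0]; exact bot_le
  · have hle : Ksdim₀ 𝒜 ≤ Ksdim₀ ℬ := by
      rw [hn, ← hasOddChain_zero_iff]
      exact h n 0 ((hasOddChain_zero_iff n).mpr hn.ge)
    rw [Ksdim, Ksdim, Prod.Lex.toLex_le_toLex]
    refine hle.lt_or_eq.imp id fun heq => ⟨heq, ?_⟩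
    exact Ksdim₁_le hn _ fun s hs => (h n s hs).le_Ksdim₁ (heq.symm.trans hn)

/-- Primes of the even part of `A_𝔭` are the primes of `A₀` inside `𝔭₀`, and denominators are units,
so they do not affect annihilators. -/
theorem hasOddChain_localization_iff (p : HomogeneousIdeal 𝒜) (hp : IsPrime p) (n s : ℕ) :
    HasOddChain (atPrimeGrading p hp) n s ↔
      ∃ l : List A, l.length = s ∧ (∀ b ∈ l, b ∈ 𝒜 1) ∧
        ∃ c : LTSeries (PrimeSpectrum (evenPart 𝒜)), c.length = n ∧
          c.last.asIdeal ≤ evenIdeal p ∧ evenAnn 𝒜 l.prod ≤ c.head.asIdeal := by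
  have hq : (evenIdeal p).IsPrime := hp.evenIdeal_isPrime
  let S := primeCompl p hp
  have hS : (evenIdeal p).primeCompl = S := rfl
  let L := evenPart (localizationGrading 𝒜 S)
  have hloc : IsLocalization.AtPrime L (evenIdeal p) := by
    change IsLocalization (evenIdeal p).primeCompl L
    rw [hS]; infer_instance
  let e := IsLocalization.AtPrime.primeSpectrumOrderIso L (evenIdeal p)
  have he : ∀ q, (e q).1.asIdeal = q.asIdeal.comap (algebraMap (evenPart 𝒜) L) := fun q => rfl
  change HasOddChain (localizationGrading 𝒜 S) n s ↔ _
  constructor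
  · rintro ⟨l, rfl, hl, c, rfl, hc⟩
    obtain ⟨l', t, hlen, hl', hprod⟩ := exists_list_of_localization l hl
    refine ⟨l', hlen, hl', ⟨c.length, fun i => (e (c i)).1, fun i => e.strictMono (c.step i)⟩,
      rfl, (e c.last).2, ?_⟩
    · intro r hr
      have := algebraMap_mem_evenAnn _ t hr
      rw [← hprod] at this
      exact hc this
  · rintro ⟨l, rfl, hl, c, rfl, hlast, hc⟩
    have hmem : ∀ i, c i ∈ Set.Iic (⟨evenIdeal p, hq⟩ : PrimeSpectrum (evenPart 𝒜)) :=
      fun i => le_trans (c.monotone (Fin.le_last i)) hlast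
    let C : LTSeries (PrimeSpectrum L) :=
      ⟨c.length, fun i => e.symm ⟨c i, hmem i⟩, fun i => e.symm.strictMono (c.step i)⟩
    have hhead : C.head.asIdeal.comap (algebraMap (evenPart 𝒜) L) = c.head.asIdeal := by
      rw [← he]
      have : e C.head = ⟨c.head, hmem 0⟩ := e.apply_symm_apply _
      rw [this]
    refine ⟨l.map fun b => LocalizedModule.mk b 1, by simp, ?_, C, rfl, ?_⟩
    · intro x hx
      obtain ⟨b, hb, rfl⟩ := List.mem_map.mp hx
      exact ⟨b, hl b hb, 1, rfl⟩
    · rw [prod_map_mk]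
      intro z hz
      obtain ⟨u, r, hur, v, hv⟩ := exists_mul_mem_evenAnn _ _ hz
      have hu : (u : evenPart 𝒜) ∉ c.head.asIdeal :=
        fun h => u.2 (hmem 0 h)
      have hr : r ∈ c.head.asIdeal := (c.head.2.mem_or_mem (hc hur)).resolve_left hu
      rw [← hhead] at hr
      rw [← hv]
      exact Ideal.mul_mem_right _ _ hr

theorem hasOddChain_completion_iff (hN : IsNoetherian 𝒜) (I : HomogeneousIdeal 𝒜) (n s : ℕ) :
    HasOddChain (completionGrading I) n s ↔
      ∃ (p : HomogeneousIdeal 𝒜) (hp : IsPrime p), I ≤ p ∧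
        HasOddChain (atPrimeGrading p hp) n s := by
  constructor
  · rintro ⟨l, rfl, hl, C, rfl, hC⟩
    obtain ⟨q, hq, hIq, l', hlen, hl', c, hc, hcq, hann⟩ := exists_chain_of_completion hN l hl C hC
    -- The prime of `A₀` produced by descent is the even part of a prime super-ideal, which still
    -- contains `I`.
    refine ⟨primeOfEven q, primeOfEven_isPrime q, le_primeOfEven q hIq, ?_⟩
    rw [hasOddChain_localization_iff]
    exact ⟨l', hlen, hl', c, hc, by rwa [evenIdeal_primeOfEven], hann⟩
  · rintro ⟨p, hp, hIp, h⟩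
    obtain ⟨l, hlen, hl, c, rfl, hcp, hann⟩ := (hasOddChain_localization_iff p hp n s).mp h
    have := hp.evenIdeal_isPrime
    obtain ⟨C, hC, hCann⟩ :=
      exists_completion_chain hN (evenIdeal p) (evenIdeal_mono hIp) l.prod c hcp hann
    refine ⟨l.map (toCompletion I), by simpa using hlen, ?_, C, hC, ?_⟩
    · intro x hx
      obtain ⟨b, hb, rfl⟩ := List.mem_map.mp hx
      exact toCompletion_mem I (hl b hb)
    · rwa [← map_list_prod]

theorem Ksdim₀_lt_top_of_hasOddChain {B : Type*} [Ring B] {ℬ : ZMod 2 → AddSubgroup B}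
    [SuperRing ℬ] (hA : Ksdim₀ 𝒜 < ⊤) (h : ∀ n, HasOddChain ℬ n 0 → HasOddChain 𝒜 n 0) :
    Ksdim₀ ℬ < ⊤ := by
  refine lt_of_le_of_lt ?_ hA
  rw [Ksdim₀, ringKrullDim, Order.krullDim]
  refine iSup_le fun c => ?_
  exact (hasOddChain_zero_iff _).mp
    (h _ ((hasOddChain_zero_iff _).mpr (Order.le_krullDim_iff.mpr ⟨c, rfl⟩)))

theorem hasOddChain_of_localization (p : HomogeneousIdeal 𝒜) (hp : IsPrime p) {n s : ℕ}
    (h : HasOddChain (atPrimeGrading p hp) n s) : HasOddChain 𝒜 n s := by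
  obtain ⟨l, hlen, hl, c, hc, -, hann⟩ := (hasOddChain_localization_iff p hp n s).mp h
  exact ⟨l, hlen, hl, c, hc, hann⟩

/-- The Krull super-dimension of the completion at `I` is the supremum of those of the
localizations at the prime super-ideals containing `I`. -/
theorem isLUB_Ksdim_atPrime (hN : IsNoetherian 𝒜) (hfin : Ksdim₀ 𝒜 < ⊤)
    (I : HomogeneousIdeal 𝒜) :
    IsLUB {d | ∃ (p : HomogeneousIdeal 𝒜) (hp : IsPrime p),
        I ≤ p ∧ d = Ksdim (atPrimeGrading p hp)} (Ksdim (completionGrading I)) := by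
  have hloc : ∀ (p : HomogeneousIdeal 𝒜) (hp : IsPrime p),
      Ksdim₀ (atPrimeGrading p hp) < ⊤ := fun p hp =>
    Ksdim₀_lt_top_of_hasOddChain hfin fun _ h => hasOddChain_of_localization p hp h
  have hcompl : Ksdim₀ (completionGrading I) < ⊤ :=
    Ksdim₀_lt_top_of_hasOddChain hfin fun n h => by
      obtain ⟨p, hp, -, h⟩ := (hasOddChain_completion_iff hN I n 0).mp h
      exact hasOddChain_of_localization p hp h
  have hle : ∀ (p : HomogeneousIdeal 𝒜) (hp : IsPrime p), I ≤ p →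
      Ksdim (atPrimeGrading p hp) ≤ Ksdim (completionGrading I) := fun p hp hIp =>
    Ksdim_mono_of_hasOddChain (hloc p hp) fun n s h =>
      (hasOddChain_completion_iff hN I n s).mpr ⟨p, hp, hIp, h⟩
  refine ⟨?_, fun d hd => ?_⟩
  · rintro _ ⟨p, hp, hIp, rfl⟩
    exact hle p hp hIp
  obtain h0 | ⟨n, hn⟩ := Ksdim₀_eq_bot_or_nat hcompl
  · rw [Ksdim_eq_bot h0]; exact bot_le
  have key : ∀ s, HasOddChain (completionGrading I) n s →
      toLex ((n : WithBot ℕ∞), (s : ℕ∞)) ≤ d := by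
    intro s hs
    obtain ⟨p, hp, hIp, h⟩ := (hasOddChain_completion_iff hN I n s).mp hs
    -- The prime `p` may vary with `s`, but its even dimension is forced to be `n`: the chain gives
    -- one inequality and comparison with the completion the other.
    have hpn : Ksdim₀ (atPrimeGrading p hp) = n := by
      refine le_antisymm ?_ ((hasOddChain_zero_iff n).mp h.zero)
      rw [← hn]
      exact Prod.Lex.monotone_fst _ _ (hle p hp hIp)
    refine le_trans ?_ (hd ⟨p, hp, hIp, rfl⟩)
    rw [Ksdim, hpn, Prod.Lex.toLex_le_toLex]
    exact .inr ⟨rfl, h.le_Ksdim₁ hpn⟩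
  -- The case `s = 0` places `n` at or below the first coordinate of `d`; odd lengths need comparing
  -- only in case of equality.
  have hzero := key 0 ((hasOddChain_zero_iff n).mpr hn.ge)
  obtain ⟨⟨m, t⟩, rfl⟩ := toLex.surjective d
  rw [Ksdim, hn, Prod.Lex.toLex_le_toLex]
  rw [Prod.Lex.toLex_le_toLex] at hzero
  refine hzero.imp id fun h => ⟨h.1, Ksdim₁_le hn _ fun s hs => ?_⟩
  have := key s hs
  rw [Prod.Lex.toLex_le_toLex] at this
  exact this.elim (fun hlt => absurd h.1 hlt.ne) fun h => h.2

end Main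

end SuperRing

theorem mainTheorem4 {A : Type*} [Ring A] (𝒜 : ZMod 2 → AddSubgroup A) [SuperRing 𝒜]
    (hN : SuperRing.IsNoetherian 𝒜) (hfin : SuperRing.Ksdim₀ 𝒜 < ⊤)
    (I : HomogeneousIdeal 𝒜) :
    IsLUB {d | ∃ (p : HomogeneousIdeal 𝒜) (hp : SuperRing.IsPrime p),
        I ≤ p ∧ d = SuperRing.Ksdim (SuperRing.atPrimeGrading p hp)}
      (SuperRing.Ksdim (SuperRing.completionGrading I)) :=
  SuperRing.isLUB_Ksdim_atPrime hN hfin I
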